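/- **Refined Compression Lemma.** An *infinitary term rewriting system* (iTRS) is a set of rules $\ell \to r$ over a first-order signature (every symbol has a finite arity) and a set of variables, where $\ell$ is a finite term that is not a variable, $r$ is a finite or infinite term, and every variable of $r$ occurs in $\ell$. It is *left-linear* if no variable occurs twice in the left-hand side of a rule. A rewrite step replaces, at a position $p$ of a finite or infinite term, an instance $\sigma(\ell)$ of the left-hand side of a rule by $\sigma(r)$; its *depth* is the length $|p|$. Distinct terms have distance $2^{-k}$, where $k$ is the least length of a position at which they differ. For an ordinal $\alpha$, a *strongly convergent* rewrite sequence $s \to^\alpha t$ consists of steps $t_\beta \to t_{\beta+1}$ at positions $p_\beta$ for all $\beta < \alpha$, with $t_0 = s$ and final term $t_\alpha = t$, such that for every limit ordinal $\lambda \le \alpha$, as $\beta$ approaches $\lambda$ from below, $t_\beta$ converges to $t_\lambda$ and the depth $|p_\beta|$ tends to infinity. Let $\mathcal R$ be a left-linear iTRS and let $\kappa : s \to^\alpha t$ be a strongly convergent rewrite sequence. Then there is a strongly convergent rewrite sequence $\kappa' : s \to^{\le\omega} t$, that is, one of length at most $\omega$, such that, if $\kappa$ has at least one step and $d$ is the minimal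 depth of a step in $\kappa$, then the number $n$ of steps of $\kappa$ at depth $d$ is finite, all steps of $\kappa'$ take place at depth $\ge d$, and precisely $n$ steps of $\kappa'$ take place at depth $d$. -/

import Mathlib

universe u v v' w

namespace InfRewriting

/-- A first-order signature: a type of symbols, each with a fixed arity. -/
structure Signature where
  Sym : Type u
  arity : Sym → ℕ

/-- A partial map from positions (finite words over `ℕ`) to symbols and variables is a term if
the root is defined and position `p · i` is defined exactly when `p` carries a function symbol
of some arity `n` with `1 ≤ i ≤ n`. -/
def IsTerm {S : Signature.{u}} {V : Type v} (g : List ℕ → Option (S.Sym ⊕ V)) : Prop :=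
  (g []).isSome ∧
    ∀ (p : List ℕ) (i : ℕ),
      (g (p ++ [i])).isSome ↔ ∃ f : S.Sym, g p = some (Sum.inl f) ∧ 1 ≤ i ∧ i ≤ S.arity f

/-- Finite and infinite terms over the signature `S` and the set of variables `V`. -/
@[ext]
structure ITerm (S : Signature.{u}) (V : Type v) where
  label : List ℕ → Option (S.Sym ⊕ V)
  isTerm : IsTerm label

/-- The set of positions of a term. -/
def ITerm.positions {S : Signature.{u}} {V : Type v} (t : ITerm S V) : Set (List ℕ) :=
  {p | (t.label p).isSome}

/-- A term is finite if it has finitely many positions. -/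
def ITerm.IsFinite {S : Signature.{u}} {V : Type v} (t : ITerm S V) : Prop :=
  t.positions.Finite

/-- The set of variables that occur in a term. -/
def ITerm.vars {S : Signature.{u}} {V : Type v} (t : ITerm S V) : Set V :=
  {x | ∃ p, t.label p = some (Sum.inr x)}

/-- The term that consists of a single variable. -/
def ITerm.var {S : Signature.{u}} {V : Type v} (x : V) : ITerm S V where
  label := fun p => if p = [] then some (Sum.inr x) else none
  isTerm := by
    refine ⟨by simp, fun p i => ?_⟩
    by_cases hp : p = [] <;> simp [hp]

/-- The labelling of the result of a substitution, by descending along the position until a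
variable is met; `ITerm.subst_at_var` and `ITerm.subst_at_of_not` below give the usual
description by cases. -/
def substFun {S : Signature.{u}} {V : Type v} {W : Type v'} (σ : V → ITerm S W) :
    List ℕ → (List ℕ → Option (S.Sym ⊕ V)) → Option (S.Sym ⊕ W)
  | p, g =>
    match g [] with
    | none => none
    | some (Sum.inr x) => (σ x).label p
    | some (Sum.inl f) =>
      match p with
      | [] => some (Sum.inl f)
      | i :: q => substFun σ q (fun r => g (i :: r))

section Lemmas

variable {S : Signature.{u}} {V : Type v} {W : Type v'} (σ : V → ITerm S W)

theorem substFun_none (p : List ℕ) (g : List ℕ → Option (S.Sym ⊕ V)) (h : g [] = none) :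
    substFun σ p g = none := by
  cases p <;> simp [substFun, h]

theorem substFun_var (p : List ℕ) (g : List ℕ → Option (S.Sym ⊕ V)) (x : V)
    (h : g [] = some (Sum.inr x)) : substFun σ p g = (σ x).label p := by
  cases p <;> simp [substFun, h]

theorem substFun_nil (g : List ℕ → Option (S.Sym ⊕ V)) (f : S.Sym)
    (h : g [] = some (Sum.inl f)) : substFun σ [] g = some (Sum.inl f) := by
  simp [substFun, h]

theorem substFun_cons (i : ℕ) (q : List ℕ) (g : List ℕ → Option (S.Sym ⊕ V)) (f : S.Sym)
    (h : g [] = some (Sum.inl f)) :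
    substFun σ (i :: q) g = substFun σ q (fun r => g (i :: r)) := by
  rw [substFun, h]

/-- The subterm labelling at a child that is defined is again that of a term. -/
theorem IsTerm.child {g : List ℕ → Option (S.Sym ⊕ V)} (hg : IsTerm g) (i : ℕ)
    (hi : (g [i]).isSome) : IsTerm (fun r => g (i :: r)) :=
  ⟨hi, fun p j => by simpa using hg.2 (i :: p) j⟩

theorem isTerm_substFun {g : List ℕ → Option (S.Sym ⊕ V)} (hg : IsTerm g) :
    IsTerm (fun p => substFun σ p g) := by
  have key : ∀ (p : List ℕ) (g : List ℕ → Option (S.Sym ⊕ V)), IsTerm g → ∀ i : ℕ,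
      ((substFun σ (p ++ [i]) g).isSome ↔
        ∃ f : S.Sym, substFun σ p g = some (Sum.inl f) ∧ 1 ≤ i ∧ i ≤ S.arity f) := by
    intro p
    induction p with
    | nil =>
      intro g hg i
      obtain ⟨a, ha⟩ := Option.isSome_iff_exists.1 hg.1
      rcases a with f | x
      · have h1 := hg.2 [] i
        rw [List.nil_append, substFun_cons σ i [] g f ha, substFun_nil σ g f ha]
        rw [List.nil_append, ha] at h1
        have h2 : (∃ f' : S.Sym, (some (Sum.inl f) : Option (S.Sym ⊕ W)) = some (Sum.inl f') ∧
            1 ≤ i ∧ i ≤ S.arity f') ↔ (g [i]).isSome := by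
          rw [h1]; simp
        rw [h2]
        rcases hb : g [i] with _ | b
        · rw [substFun_none σ [] _ hb]; simp
        · rcases b with f' | y
          · rw [substFun_nil σ _ f' hb]; simp
          · rw [substFun_var σ [] _ y hb]; simpa using (σ y).isTerm.1
      · rw [substFun_var σ _ g x ha, substFun_var σ _ g x ha]
        exact (σ x).isTerm.2 [] i
    | cons j q ih =>
      intro g hg i
      obtain ⟨a, ha⟩ := Option.isSome_iff_exists.1 hg.1
      rcases a with f | x
      · rw [List.cons_append, substFun_cons σ j _ g f ha, substFun_cons σ j _ g f ha]
        by_cases hj : (g [j]).isSome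
        · exact ih _ (hg.child j hj) i
        · have hj' : g [j] = none := by simpa using hj
          rw [substFun_none σ _ (fun r => g (j :: r)) hj',
            substFun_none σ _ (fun r => g (j :: r)) hj']
          simp
      · rw [substFun_var σ _ g x ha, substFun_var σ _ g x ha]
        exact (σ x).isTerm.2 (j :: q) i
  refine ⟨?_, fun p i => key p g hg i⟩
  obtain ⟨a, ha⟩ := Option.isSome_iff_exists.1 hg.1
  rcases a with f | x
  · simp [substFun_nil σ g f ha]
  · simpa [substFun_var σ [] g x ha] using (σ x).isTerm.1

end Lemmas

/-- The result of replacing every variable `x` of a term by `σ x`. -/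
def ITerm.subst {S : Signature.{u}} {V : Type v} {W : Type v'} (σ : V → ITerm S W)
    (t : ITerm S V) : ITerm S W where
  label := fun p => substFun σ p t.label
  isTerm := isTerm_substFun σ t.isTerm

/-- At or below a position that carries the variable `x`, the instance looks like `σ x`. -/
theorem ITerm.subst_at_var {S : Signature.{u}} {V : Type v} {W : Type v'}
    (σ : V → ITerm S W) (t : ITerm S V) (p q : List ℕ) (x : V)
    (h : t.label p = some (Sum.inr x)) : (t.subst σ).label (p ++ q) = (σ x).label q := by
  suffices H : ∀ (p : List ℕ) (g : List ℕ → Option (S.Sym ⊕ V)), IsTerm g →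
      g p = some (Sum.inr x) → substFun σ (p ++ q) g = (σ x).label q from H p _ t.isTerm h
  intro p
  induction p with
  | nil => intro g _ h; exact substFun_var σ q g x h
  | cons i r ih =>
    intro g hg h
    have hchild : ∀ r : List ℕ, (g (i :: r)).isSome → (g [i]).isSome := by
      intro r
      induction r using List.reverseRecOn with
      | nil => exact id
      | append_singleton r j ihr =>
        intro hr
        obtain ⟨f, hf, -⟩ := (hg.2 (i :: r) j).1 (by simpa using hr)
        exact ihr (by simp [hf])
    have hi := hchild r (by simp [h])
    obtain ⟨f, hf, -⟩ := (hg.2 [] i).1 (by simpa using hi)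
    rw [List.cons_append, substFun_cons σ i _ g f hf]
    exact ih _ (hg.child i hi) h

/-- At a position that has no prefix carrying a variable, the instance looks like the term. -/
theorem ITerm.subst_at_of_not {S : Signature.{u}} {V : Type v} {W : Type v'}
    (σ : V → ITerm S W) (t : ITerm S V) (p : List ℕ)
    (h : ∀ q r x, p = q ++ r → t.label q ≠ some (Sum.inr x)) :
    ((t.subst σ).label p = none ∧ t.label p = none) ∨
      ∃ f, (t.subst σ).label p = some (Sum.inl f) ∧ t.label p = some (Sum.inl f) := by
  suffices H : ∀ (p : List ℕ) (g : List ℕ → Option (S.Sym ⊕ V)), IsTerm g →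
      (∀ q r x, p = q ++ r → g q ≠ some (Sum.inr x)) →
      (substFun σ p g = none ∧ g p = none) ∨
        ∃ f, substFun σ p g = some (Sum.inl f) ∧ g p = some (Sum.inl f) from H p _ t.isTerm h
  intro p
  induction p with
  | nil =>
    intro g hg h
    obtain ⟨a, ha⟩ := Option.isSome_iff_exists.1 hg.1
    rcases a with f | x
    · exact Or.inr ⟨f, substFun_nil σ g f ha, ha⟩
    · exact absurd ha (h [] [] x rfl)
  | cons i r ih =>
    intro g hg h
    obtain ⟨a, ha⟩ := Option.isSome_iff_exists.1 hg.1
    rcases a with f | x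
    · rw [substFun_cons σ i _ g f ha]
      by_cases hi : (g [i]).isSome
      · exact ih _ (hg.child i hi) (fun q r' x e => h (i :: q) r' x (by simp [e]))
      · have hi' : g [i] = none := by simpa using hi
        refine Or.inl ⟨substFun_none σ _ _ hi', ?_⟩
        have hnone : ∀ r : List ℕ, g (i :: r) = none := by
          intro r
          induction r using List.reverseRecOn with
          | nil => exact hi'
          | append_singleton r j ihr =>
            by_contra hne
            obtain ⟨f', hf', -⟩ := (hg.2 (i :: r) j).1
              (by simpa [Option.isSome_iff_ne_none] using hne)
            simp [ihr] at hf'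
        exact hnone r
    · exact absurd ha (h [] (i :: r) x rfl)

/-- A one-hole context with its hole at position `p`: a term over the variables together with
one fresh variable (`none`, the hole) that occurs at `p` and nowhere else. -/
def IsContextAt {S : Signature.{u}} {V : Type v} (C : ITerm S (Option V)) (p : List ℕ) : Prop :=
  ∀ q : List ℕ, C.label q = some (Sum.inr none) ↔ q = p

/-- Filling the hole of a context. -/
def ITerm.fill {S : Signature.{u}} {V : Type v} (C : ITerm S (Option V)) (s : ITerm S V) :
    ITerm S V :=
  C.subst (fun o => o.elim s ITerm.var)

/-- An infinitary rewrite rule: the left-hand side is a finite term that is not a variable, the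
right-hand side is a finite or infinite term all of whose variables occur in the left-hand side. -/
structure IRule (S : Signature.{u}) (V : Type v) where
  lhs : ITerm S V
  rhs : ITerm S V
  lhs_finite : lhs.IsFinite
  lhs_not_var : ∀ x : V, lhs.label [] ≠ some (Sum.inr x)
  vars_subset : rhs.vars ⊆ lhs.vars

/-- An infinitary term rewriting system over a signature and a set of variables. -/
structure ITRS (S : Signature.{u}) (V : Type v) where
  rules : Set (IRule S V)

/-- No variable occurs twice in the left-hand side of a rule. -/
def ITRS.LeftLinear {S : Signature.{u}} {V : Type v} (R : ITRS S V) : Prop :=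
  ∀ ρ ∈ R.rules, ∀ (p q : List ℕ) (x : V),
    ρ.lhs.label p = some (Sum.inr x) → ρ.lhs.label q = some (Sum.inr x) → p = q

/-- `R.StepAt p s t`: there is a rewrite step from `s` to `t` at position `p`. -/
def ITRS.StepAt {S : Signature.{u}} {V : Type v} (R : ITRS S V) (p : List ℕ)
    (s t : ITerm S V) : Prop :=
  ∃ ρ ∈ R.rules, ∃ (σ : V → ITerm S V) (C : ITerm S (Option V)),
    IsContextAt C p ∧ s = C.fill (ρ.lhs.subst σ) ∧ t = C.fill (ρ.rhs.subst σ)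

open Classical in
/-- The metric on terms: `2 ^ (-k)`, where `k` is the least length of a position at which the
terms differ, and `0` for equal terms. -/
noncomputable def termDist {S : Signature.{u}} {V : Type v} (s t : ITerm S V) : ℝ :=
  if s = t then 0
  else (2⁻¹ : ℝ) ^ sInf {k : ℕ | ∃ p : List ℕ, p.length = k ∧ s.label p ≠ t.label p}

/-- The terms `f β` converge to `t` as `β` approaches `l` from below. -/
def TermsTendTo {S : Signature.{u}} {V : Type v} (f : Ordinal.{w} → ITerm S V)
    (l : Ordinal.{w}) (t : ITerm S V) : Prop :=
  ∀ ε : ℝ, 0 < ε → ∃ γ < l, ∀ β, γ ≤ β → β < l → termDist (f β) t < ε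

/-- The lengths of the positions `f β` tend to infinity as `β` approaches `l` from below. -/
def DepthsTendToInfinity (f : Ordinal.{w} → List ℕ) (l : Ordinal.{w}) : Prop :=
  ∀ k : ℕ, ∃ γ < l, ∀ β, γ ≤ β → β < l → k < (f β).length

/-- A (strongly continuous) transfinite rewrite sequence of length `α`. Only the values `pos β`
for `β < α` and `term β` for `β < α`, and `term α` if `α` is not a limit ordinal, matter. -/
structure RewriteSeq {S : Signature.{u}} {V : Type v} (R : ITRS S V) (α : Ordinal.{w}) where
  term : Ordinal.{w} → ITerm S V
  pos : Ordinal.{w} → List ℕ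
  step : ∀ β < α, R.StepAt (pos β) (term β) (term (Order.succ β))
  term_cont : ∀ l < α, Order.IsSuccLimit l → TermsTendTo term l (term l)
  depth_cont : ∀ l < α, Order.IsSuccLimit l → DepthsTendToInfinity pos l

namespace RewriteSeq

variable {S : Signature.{u}} {V : Type v} {R : ITRS S V} {α : Ordinal.{w}}

/-- The depth of the step with index `β`. -/
def depth (κ : RewriteSeq R α) (β : Ordinal.{w}) : ℕ := (κ.pos β).length

/-- Strong convergence: if the length is a limit ordinal then the depth of the steps tends to
infinity there, too. -/
def StronglyConvergent (κ : RewriteSeq R α) : Prop :=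
  Order.IsSuccLimit α → DepthsTendToInfinity κ.pos α

/-- `t` is the final term of the sequence; for limit length, `t` is the limit of its terms. -/
def HasTarget (κ : RewriteSeq R α) (t : ITerm S V) : Prop :=
  (Order.IsSuccLimit α → TermsTendTo κ.term α t) ∧ (¬ Order.IsSuccLimit α → κ.term α = t)

/-- The sequence is a strongly convergent reduction from `s` to `t`. -/
def Reduces (κ : RewriteSeq R α) (s t : ITerm S V) : Prop :=
  κ.term 0 = s ∧ κ.StronglyConvergent ∧ κ.HasTarget t

/-- The indices of the steps at depth `d`. -/
def stepsAt (κ : RewriteSeq R α) (d : ℕ) : Set Ordinal.{w} := {β | β < α ∧ κ.depth β = d}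

/-- The set of the depths of all steps. -/
def depths (κ : RewriteSeq R α) : Set ℕ := {k | ∃ β < α, κ.depth β = k}

end RewriteSeq

end InfRewriting

/-! Sequences of length at most ω are handled coinductively. `R.Compressed g h` says that finitely
many steps from `g` produce the root of `h`, and that the same holds again below each child;
`R.CompressedFrom k` asks for this only below depth `k`, with agreement above. Since terms branch
finitely, `CompressedFrom.extract` raises `k` by one at the price of finitely many steps at depth at
least `k`. Iterating it gives a strongly convergent sequence of length at most ω;
`CompressedFrom.coinduct` is the converse principle.

The heart is `CompressedFrom.project`. A left-hand side is a finite linear pattern, so a redex of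
`v` is already present in every `u` that agrees with `v` deeply enough, and the two contracta are
again related. Hence a step that follows an infinite sequence can be performed after a finite part
of it (`CompressedFrom.commute`), which yields closure under appending steps and under composition
(`CompressedFrom.tail`, `CompressedFrom.trans`).

For a transfinite sequence, strong convergence provides a last step of depth at most `k`, unless
there is none (`exists_last`). The part before that step is compressed by induction on the ordinal,
the step itself is appended, and all later steps are deeper than `k`; coinduction on `k` concludes.

For the count, let `d` be the minimal depth. Moving a step of depth `d` forward by `commute` puts
only steps of depth greater than `d` in front of it. So all steps of depth `d` end up, one for one,
in a finite initial path, and what remains to be done is `CompressedFrom (d + 1)`, which needs no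
step of depth `d`. -/

namespace InfRewriting

/-! ### Labellings and rewrite steps without contexts -/

section Labels

variable {S : Signature.{u}} {V : Type v}

/-- Arbitrary labellings of positions. -/
abbrev Labelling (S : Signature.{u}) (V : Type v) := List ℕ → Option (S.Sym ⊕ V)

/-- A labelling that is that of a term or empty. -/
def IsPreterm (g : Labelling S V) : Prop :=
  ∀ (p : List ℕ) (i : ℕ),
    (g (p ++ [i])).isSome ↔ ∃ f : S.Sym, g p = some (Sum.inl f) ∧ 1 ≤ i ∧ i ≤ S.arity f

/-- The labelling below a position. -/
def below (g : Labelling S V) (q : List ℕ) : Labelling S V := fun r => g (q ++ r)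

theorem below_below (g : Labelling S V) (p q : List ℕ) :
    below (below g p) q = below g (p ++ q) := by
  funext r; simp [below]

theorem below_nil (g : Labelling S V) : below g [] = g := rfl

theorem ITerm.isPreterm (t : ITerm S V) : IsPreterm t.label := t.isTerm.2

theorem IsPreterm.below {g : Labelling S V} (hg : IsPreterm g) (q : List ℕ) :
    IsPreterm (below g q) := fun p i => by
  simpa [InfRewriting.below] using hg (q ++ p) i

theorem IsPreterm.eq_none {g : Labelling S V} (hg : IsPreterm g) {q : List ℕ}
    (h : g q = none) (r : List ℕ) : g (q ++ r) = none := by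
  induction r using List.reverseRecOn with
  | nil => simpa using h
  | append_singleton r i ih =>
    by_contra hne
    obtain ⟨f, hf, -⟩ := (hg (q ++ r) i).1 (by
      simpa [Option.isSome_iff_ne_none] using hne)
    simp [ih] at hf

theorem labelling_ext {g h : Labelling S V} (h0 : g [] = h [])
    (hc : ∀ i, below g [i] = below h [i]) : g = h := by
  funext p
  cases p with
  | nil => exact h0
  | cons i r => exact congrFun (hc i) r

/-- The labelling with the given root label and the given labellings below the root. -/
def node (a : Option (S.Sym ⊕ V)) (c : ℕ → Labelling S V) : Labelling S V
  | [] => a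
  | i :: r => c i r

theorem node_nil (a : Option (S.Sym ⊕ V)) (c : ℕ → Labelling S V) : node a c [] = a := rfl

theorem below_node (a : Option (S.Sym ⊕ V)) (c : ℕ → Labelling S V) (i : ℕ) :
    below (node a c) [i] = c i := rfl

/-- A rewrite step at position `p`, in terms of labellings. -/
def ITRS.LabelStep (R : ITRS S V) (p : List ℕ) (g h : Labelling S V) : Prop :=
  ∃ ρ ∈ R.rules, ∃ σ : V → ITerm S V,
    below g p = (ρ.lhs.subst σ).label ∧ below h p = (ρ.rhs.subst σ).label ∧
      ∀ q, ¬ p <+: q → g q = h q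

variable {R : ITRS S V}

theorem ITRS.LabelStep.isSome {p : List ℕ} {g h : Labelling S V} (hs : R.LabelStep p g h) :
    (g p).isSome := by
  obtain ⟨ρ, -, σ, h1, -, -⟩ := hs
  have := congrFun h1 []
  simp only [below, List.append_nil] at this
  rw [this]
  exact (ρ.lhs.subst σ).isTerm.1

theorem ITRS.LabelStep.isSome_right {p : List ℕ} {g h : Labelling S V}
    (hs : R.LabelStep p g h) : (h p).isSome := by
  obtain ⟨ρ, -, σ, -, h1, -⟩ := hs
  have := congrFun h1 []
  simp only [below, List.append_nil] at this
  rw [this]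
  exact (ρ.rhs.subst σ).isTerm.1

theorem ITRS.LabelStep.isPreterm {p : List ℕ} {g h : Labelling S V} (hs : R.LabelStep p g h)
    (hg : IsPreterm g) : IsPreterm h := by
  intro q i
  by_cases hpq : p <+: q
  · obtain ⟨r, rfl⟩ := hpq
    obtain ⟨ρ, -, σ, -, h2, -⟩ := hs
    have e1 := congrFun h2 (r ++ [i])
    have e2 := congrFun h2 r
    simp only [below] at e1 e2
    rw [List.append_assoc, e1, e2]
    exact (ρ.rhs.subst σ).isTerm.2 r i
  · by_cases hpq' : p <+: q ++ [i]
    · have hp : p = q ++ [i] := by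
        rcases List.prefix_concat_iff.1 hpq' with h | h
        · exact h
        · exact absurd h hpq
      obtain ⟨ρ, -, σ, -, -, h3⟩ := id hs
      rw [← h3 q hpq, ← hg q i, ← hp]
      simp [hs.isSome, hs.isSome_right]
    · obtain ⟨ρ, -, σ, -, -, h3⟩ := hs
      rw [← h3 q hpq, ← h3 _ hpq']
      exact hg q i

theorem ITRS.LabelStep.eq_of_length_lt {p : List ℕ} {g h : Labelling S V}
    (hs : R.LabelStep p g h) {q : List ℕ} (hq : q.length < p.length) : g q = h q := by
  obtain ⟨ρ, -, σ, -, -, h3⟩ := hs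
  exact h3 q fun hpq => absurd hpq.length_le (by omega)

/-- As `p` is no shorter than `q`, it either extends `q` or is parallel to it; a parallel step is
invisible below `q`. -/
theorem ITRS.LabelStep.below {p : List ℕ} {g h : Labelling S V} (hs : R.LabelStep p g h)
    {q : List ℕ} (hq : q.length ≤ p.length) :
    (∃ p', p = q ++ p' ∧ R.LabelStep p' (below g q) (below h q)) ∨ below g q = below h q := by
  obtain ⟨ρ, hρ, σ, h1, h2, h3⟩ := hs
  by_cases hqp : q <+: p
  · obtain ⟨p', rfl⟩ := hqp
    refine Or.inl ⟨p', rfl, ρ, hρ, σ, by rw [below_below, h1], by rw [below_below, h2], ?_⟩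
    intro r hr
    exact h3 _ (by rwa [List.prefix_append_right_inj])
  · right
    funext r
    exact h3 _ fun h => hqp (List.prefix_of_prefix_length_le (List.prefix_append q r) h hq)

theorem ITRS.LabelStep.cons {p : List ℕ} {g h : Labelling S V} {i : ℕ} (h0 : g [] = h [])
    (hi : R.LabelStep p (InfRewriting.below g [i]) (InfRewriting.below h [i]))
    (hj : ∀ j, j ≠ i → InfRewriting.below g [j] = InfRewriting.below h [j]) :
    R.LabelStep (i :: p) g h := by
  obtain ⟨ρ, hρ, σ, h1, h2, h3⟩ := hi
  refine ⟨ρ, hρ, σ, by rw [← h1, below_below]; rfl, by rw [← h2, below_below]; rfl, ?_⟩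
  rintro (_ | ⟨j, q⟩) hq
  · exact h0
  · by_cases hji : j = i
    · subst hji
      exact h3 q fun hpq => hq (by simpa using hpq)
    · exact congrFun (hj j hji) q

theorem ITRS.LabelStep.root_eq {p : List ℕ} {g h : Labelling S V} {i : ℕ}
    (hs : R.LabelStep (i :: p) g h) : g [] = h [] :=
  hs.eq_of_length_lt (by simp)

theorem ITRS.LabelStep.child {p : List ℕ} {g h : Labelling S V} {i : ℕ}
    (hs : R.LabelStep (i :: p) g h) :
    R.LabelStep p (InfRewriting.below g [i]) (InfRewriting.below h [i]) := by
  obtain ⟨ρ, hρ, σ, h1, h2, h3⟩ := hs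
  refine ⟨ρ, hρ, σ, by rw [below_below]; exact h1, by rw [below_below]; exact h2, ?_⟩
  intro r hr
  exact h3 _ (by simpa using hr)

theorem ITRS.LabelStep.child_of_ne {p : List ℕ} {g h : Labelling S V} {i j : ℕ}
    (hs : R.LabelStep (i :: p) g h) (hj : j ≠ i) :
    InfRewriting.below g [j] = InfRewriting.below h [j] := by
  obtain ⟨ρ, hρ, σ, h1, h2, h3⟩ := hs
  funext r
  refine h3 _ ?_
  simp [Ne.symm hj]

/-! ### Equivalence with steps through contexts -/

theorem ITerm.fill_label_hole (C : ITerm S (Option V)) {p : List ℕ} (hC : IsContextAt C p)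
    (s : ITerm S V) : below (C.fill s).label p = s.label := by
  funext q
  exact ITerm.subst_at_var _ C p q none ((hC p).2 rfl)

theorem ITerm.fill_label_of_not_prefix (C : ITerm S (Option V)) {p : List ℕ}
    (hC : IsContextAt C p) (s t : ITerm S V) {q : List ℕ} (hq : ¬ p <+: q) :
    (C.fill s).label q = (C.fill t).label q := by
  by_cases hv : ∃ q' r x, q = q' ++ r ∧ C.label q' = some (Sum.inr x)
  · obtain ⟨q', r, x, rfl, hx⟩ := hv
    unfold ITerm.fill
    rw [ITerm.subst_at_var _ C q' r x hx, ITerm.subst_at_var _ C q' r x hx]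
    cases x with
    | none => exact absurd ⟨r, by rw [(hC q').1 hx]⟩ hq
    | some x => rfl
  · have hv' : ∀ q' r x, q = q' ++ r → C.label q' ≠ some (Sum.inr x) :=
      fun q' r x e h => hv ⟨q', r, x, e, h⟩
    unfold ITerm.fill
    rcases ITerm.subst_at_of_not (fun o => o.elim s ITerm.var) C q hv' with ⟨h1, h2⟩ | ⟨f, h1, h2⟩ <;>
    rcases ITerm.subst_at_of_not (fun o => o.elim t ITerm.var) C q hv' with
      ⟨h3, h4⟩ | ⟨f', h3, h4⟩
    · rw [h1, h3]
    · simp [h2] at h4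
    · simp [h2] at h4
    · rw [h2] at h4
      simp only [Option.some.injEq, Sum.inl.injEq] at h4
      rw [h1, h3, h4]

/-- With the converse `LabelStep.stepAt`, this removes contexts from the argument. Labellings are
preferred to terms because `below` is then total: below an undefined position of a term it is the
empty labelling, which is not a term. -/
theorem ITRS.StepAt.labelStep {p : List ℕ} {s t : ITerm S V} (h : R.StepAt p s t) :
    R.LabelStep p s.label t.label := by
  obtain ⟨ρ, hρ, σ, C, hC, rfl, rfl⟩ := h
  exact ⟨ρ, hρ, σ, C.fill_label_hole hC _, C.fill_label_hole hC _,
    fun q hq => C.fill_label_of_not_prefix hC _ _ hq⟩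

open Classical in
/-- The context obtained from a term by putting the hole at position `p`. -/
noncomputable def ITerm.contextAt (s : ITerm S V) (p : List ℕ) (hp : (s.label p).isSome) :
    ITerm S (Option V) where
  label q := if q = p then some (Sum.inr none) else if p <+: q then none else
    (s.label q).map (Sum.map id some)
  isTerm := by
    refine ⟨?_, fun q i => ?_⟩
    · by_cases h : [] = p
      · simp [h]
      · have h' : ¬ p <+: [] := by simpa using fun h' : p = [] => h h'.symm
        simpa [h, h'] using s.isTerm.1
    · have key := s.isTerm.2 q i
      have hmap : (∃ f, Option.map (Sum.map id some) (s.label q) =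
          some (Sum.inl f : S.Sym ⊕ Option V) ∧ 1 ≤ i ∧ i ≤ S.arity f) ↔
          ∃ f, s.label q = some (Sum.inl f) ∧ 1 ≤ i ∧ i ≤ S.arity f := by
        rcases s.label q with _ | (f | x) <;> simp
      by_cases hpq : p <+: q
      · have h1 : p <+: q ++ [i] := hpq.trans (List.prefix_append _ _)
        have h2 : q ++ [i] ≠ p := by
          rintro rfl
          have := hpq.length_le
          simp at this
        by_cases hqp : q = p
        · subst hqp; simp
        · simp [h1, h2, hpq, hqp]
      · have hqp : q ≠ p := by rintro rfl; exact hpq List.prefix_rfl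
        beta_reduce
        rw [if_neg hqp, if_neg hpq, hmap, ← key]
        by_cases h2 : q ++ [i] = p
        · rw [if_pos h2, h2]; simp [hp]
        · have h1 : ¬ p <+: q ++ [i] := by
            rw [List.prefix_concat_iff]
            rintro (h | h)
            · exact h2 h.symm
            · exact hpq h
          rw [if_neg h2, if_neg h1]; simp

theorem ITerm.isContextAt_contextAt (s : ITerm S V) (p : List ℕ) (hp : (s.label p).isSome) :
    IsContextAt (s.contextAt p hp) p := by
  intro q
  simp only [ITerm.contextAt]
  split_ifs with h1 h2
  · simp [h1]
  · simp [h1]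
  · rcases s.label q with _ | (f | x) <;> simp [h1]

theorem ITerm.label_eq_fill_contextAt (s t : ITerm S V) (p : List ℕ) (hp : (s.label p).isSome)
    {q : List ℕ} (hq : ¬ p <+: q) :
    ((s.contextAt p hp).fill t).label q = s.label q := by
  have hpre : ∀ q' r, q = q' ++ r → ¬ p <+: q' :=
    fun q' r e h => hq (h.trans ⟨r, e.symm⟩)
  have hlab : ∀ q' r, q = q' ++ r →
      (s.contextAt p hp).label q' = (s.label q').map (Sum.map id some) := by
    intro q' r e
    have h1 := hpre q' r e
    have h2 : q' ≠ p := by rintro rfl; exact h1 List.prefix_rfl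
    simp [ITerm.contextAt, h1, h2]
  unfold ITerm.fill
  by_cases hv : ∃ q' r x, q = q' ++ r ∧ s.label q' = some (Sum.inr x)
  · obtain ⟨q', r, x, rfl, hx⟩ := hv
    rw [ITerm.subst_at_var _ _ q' r (some x) (by rw [hlab q' r rfl, hx]; rfl)]
    cases r with
    | nil => simp [ITerm.var, hx]
    | cons i r =>
      have h1 : s.label (q' ++ [i]) = none := by
        by_contra hne
        obtain ⟨f, hf, -⟩ := (s.isTerm.2 q' i).1 (by simpa [Option.isSome_iff_ne_none] using hne)
        simp [hx] at hf
      have := s.isPreterm.eq_none h1 r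
      simp only [List.append_assoc, List.singleton_append] at this
      simp [ITerm.var, this]
  · have hv' : ∀ q' r x, q = q' ++ r → (s.contextAt p hp).label q' ≠ some (Sum.inr x) := by
      intro q' r x e h
      rw [hlab q' r e] at h
      rcases hs : s.label q' with _ | (f | y)
      · simp [hs] at h
      · simp [hs] at h
      · exact hv ⟨q', r, y, e, hs⟩
    have hl := hlab q [] (by simp)
    rcases ITerm.subst_at_of_not (fun o => o.elim t ITerm.var) _ q hv' with
      ⟨h1, h2⟩ | ⟨f, h1, h2⟩ <;> rw [h1] <;> rw [hl] at h2 <;>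
      rcases hs : s.label q with _ | (f' | y) <;> simp_all

theorem ITRS.LabelStep.stepAt {p : List ℕ} {s t : ITerm S V}
    (h : R.LabelStep p s.label t.label) : R.StepAt p s t := by
  have hp := h.isSome
  obtain ⟨ρ, hρ, σ, h1, h2, h3⟩ := h
  refine ⟨ρ, hρ, σ, s.contextAt p hp, s.isContextAt_contextAt p hp, ?_, ?_⟩
  · ext1
    funext q
    by_cases hq : p <+: q
    · obtain ⟨r, rfl⟩ := hq
      have e := (s.contextAt p hp).fill_label_hole (s.isContextAt_contextAt p hp) (ρ.lhs.subst σ)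
      exact (congrFun h1 r).trans (congrFun e r).symm
    · rw [s.label_eq_fill_contextAt _ p hp hq]
  · ext1
    funext q
    by_cases hq : p <+: q
    · obtain ⟨r, rfl⟩ := hq
      have e := (s.contextAt p hp).fill_label_hole (s.isContextAt_contextAt p hp) (ρ.rhs.subst σ)
      exact (congrFun h2 r).trans (congrFun e r).symm
    · rw [s.label_eq_fill_contextAt _ p hp hq, h3 q hq]

end Labels

end InfRewriting

namespace InfRewriting

/-! ### Coinductive compression -/

section Compression

variable {S : Signature.{u}} {V : Type v}

/-- Finite rewrite sequences with all steps at depth at least `k`. -/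
def ITRS.DeepSteps (R : ITRS S V) (k : ℕ) : Labelling S V → Labelling S V → Prop :=
  Relation.ReflTransGen fun g h => ∃ p : List ℕ, k ≤ p.length ∧ R.LabelStep p g h

/-- The coinductive form of rewrite sequences of length at most `ω`: finitely many steps, and
then sequences of the same kind below the root. -/
def ITRS.Compressed (R : ITRS S V) (g h : Labelling S V) : Prop :=
  ∃ X : Labelling S V → Labelling S V → Prop, X g h ∧ ∀ a b, X a b →
    ∃ c, R.DeepSteps 0 a c ∧ c [] = b [] ∧ ∀ i, X (below c [i]) (below b [i])

/-- The labellings agree at depth less than `k`, and are related by `ITRS.Compressed` below. -/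
def ITRS.CompressedFrom (R : ITRS S V) : ℕ → Labelling S V → Labelling S V → Prop
  | 0, g, h => R.Compressed g h
  | k + 1, g, h => g [] = h [] ∧ ∀ i, R.CompressedFrom k (below g [i]) (below h [i])

namespace ITRS

variable {R : ITRS S V}

theorem LabelStep.deepSteps {k : ℕ} {p : List ℕ} {g h : Labelling S V}
    (hs : R.LabelStep p g h) (hk : k ≤ p.length) : R.DeepSteps k g h :=
  Relation.ReflTransGen.single ⟨p, hk, hs⟩

theorem DeepSteps.mono {k l : ℕ} (hkl : k ≤ l) {g h : Labelling S V} (hs : R.DeepSteps l g h) :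
    R.DeepSteps k g h := by
  induction hs with
  | refl => exact Relation.ReflTransGen.refl
  | tail _ h ih => obtain ⟨p, hp, hs⟩ := h; exact ih.tail ⟨p, hkl.trans hp, hs⟩

theorem DeepSteps.trans {k : ℕ} {g h m : Labelling S V} (h1 : R.DeepSteps k g h)
    (h2 : R.DeepSteps k h m) : R.DeepSteps k g m :=
  Relation.ReflTransGen.trans h1 h2

theorem DeepSteps.isPreterm {k : ℕ} {g h : Labelling S V} (hs : R.DeepSteps k g h)
    (hg : IsPreterm g) : IsPreterm h := by
  induction hs with
  | refl => exact hg
  | tail _ h ih => obtain ⟨p, -, hp⟩ := h; exact hp.isPreterm ih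

theorem DeepSteps.eq_of_length_lt {k : ℕ} {g h : Labelling S V} (hs : R.DeepSteps k g h)
    {q : List ℕ} (hq : q.length < k) : g q = h q := by
  induction hs with
  | refl => rfl
  | tail _ h ih => obtain ⟨p, hk, hp⟩ := h; rw [ih, hp.eq_of_length_lt (by omega)]

theorem DeepSteps.below {k : ℕ} {q : List ℕ} {g h : Labelling S V}
    (hs : R.DeepSteps (q.length + k) g h) :
    R.DeepSteps k (below g q) (below h q) := by
  induction hs with
  | refl => exact Relation.ReflTransGen.refl
  | tail _ h ih =>
    obtain ⟨p, hk, hp⟩ := h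
    rcases hp.below (q := q) (by omega) with ⟨p', rfl, hp'⟩ | he
    · exact ih.tail ⟨p', by simpa using hk, hp'⟩
    · rwa [← he]

theorem DeepSteps.eq_of_none {k : ℕ} {g h : Labelling S V} (hs : R.DeepSteps k g h)
    (hg : ∀ p, g p = none) : h = g := by
  induction hs with
  | refl => rfl
  | tail _ h ih =>
    obtain ⟨p, -, hp⟩ := h
    have := hp.isSome
    simp [ih, hg] at this

theorem DeepSteps.node_update {k : ℕ} {a : Option (S.Sym ⊕ V)} {c : ℕ → Labelling S V} {i : ℕ}
    {h : Labelling S V} (hs : R.DeepSteps k (c i) h) :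
    R.DeepSteps (k + 1) (node a c) (node a (Function.update c i h)) := by
  induction hs with
  | refl => rw [Function.update_eq_self]; exact Relation.ReflTransGen.refl
  | @tail h1 h2 _ h ih =>
    obtain ⟨p, hk, hp⟩ := h
    refine ih.tail ⟨i :: p, by simpa using hk, ?_⟩
    refine LabelStep.cons rfl (by simpa [below_node] using hp) fun j hj => ?_
    simp [below_node, hj]

/-- Only finitely many children are nonempty, so their finite sequences can be run one child after
the other. An empty child admits no step, so there is nothing to do beyond the arity. -/
theorem DeepSteps.node {k : ℕ} {g : Labelling S V} (hg : IsPreterm g) {c : ℕ → Labelling S V}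
    (hs : ∀ i, R.DeepSteps k (InfRewriting.below g [i]) (c i)) :
    R.DeepSteps (k + 1) g (node (g []) c) := by
  have key : ∀ N : ℕ, R.DeepSteps (k + 1) g
      (InfRewriting.node (g []) fun i => if i < N then c i else InfRewriting.below g [i]) := by
    intro N
    induction N with
    | zero =>
      have : InfRewriting.node (g []) (fun i => if i < 0 then c i else InfRewriting.below g [i]) = g :=
        labelling_ext rfl fun i => by simp [below_node]
      rw [this]
      exact Relation.ReflTransGen.refl
    | succ N ih =>
      have h1 : R.DeepSteps k ((fun i => if i < N then c i else InfRewriting.below g [i]) N)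
          (c N) := by simpa using hs N
      have h2 := DeepSteps.node_update (a := g [])
        (c := fun i => if i < N then c i else InfRewriting.below g [i]) (i := N) h1
      have h3 : Function.update (fun i => if i < N then c i else InfRewriting.below g [i]) N (c N)
          = fun i => if i < N + 1 then c i else InfRewriting.below g [i] := by
        funext i
        by_cases hi : i = N
        · subst hi; simp
        · have : i < N + 1 ↔ i < N := by omega
          simp [hi, this]
      rw [h3] at h2
      exact ih.trans h2
  obtain ⟨N, hN⟩ : ∃ N : ℕ, ∀ i, N ≤ i → g [i] = none := by
    rcases h0 : g [] with _ | (f | x)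
    · exact ⟨0, fun i _ => hg.eq_none h0 [i]⟩
    · refine ⟨S.arity f + 1, fun i hi => ?_⟩
      by_contra hne
      obtain ⟨f', hf', -, h2⟩ := (hg [] i).1 (by simpa [Option.isSome_iff_ne_none] using hne)
      simp only [h0, Option.some.injEq, Sum.inl.injEq] at hf'
      subst hf'
      omega
    · refine ⟨0, fun i hi => ?_⟩
      by_contra hne
      obtain ⟨f', hf', -, h2⟩ := (hg [] i).1 (by simpa [Option.isSome_iff_ne_none] using hne)
      simp [h0] at hf'
  have h1 : (fun i => if i < N then c i else InfRewriting.below g [i]) = c := by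
    funext i
    by_cases hi : i < N
    · simp [hi]
    · rw [if_neg hi]
      exact ((hs i).eq_of_none fun p => hg.eq_none (hN i (by omega)) p).symm
  rw [← h1]
  exact key N

theorem Compressed.unfold {g h : Labelling S V} (hgh : R.Compressed g h) :
    ∃ c, R.DeepSteps 0 g c ∧ R.CompressedFrom 1 c h := by
  obtain ⟨X, hX, hX'⟩ := hgh
  obtain ⟨c, h1, h2, h3⟩ := hX' g h hX
  exact ⟨c, h1, h2, fun i => ⟨X, h3 i, hX'⟩⟩

/-- Coinduction up to compressed pairs: the derivation may stop at any pair already known to be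
compressed. -/
theorem Compressed.coinduct (X : Labelling S V → Labelling S V → Prop)
    (hX : ∀ a b, X a b → ∃ c, R.DeepSteps 0 a c ∧ c [] = b [] ∧
      ∀ i, X (InfRewriting.below c [i]) (InfRewriting.below b [i]) ∨
        R.Compressed (InfRewriting.below c [i]) (InfRewriting.below b [i]))
    {g h : Labelling S V} (hgh : X g h) : R.Compressed g h := by
  refine ⟨fun a b => X a b ∨ R.Compressed a b, Or.inl hgh, ?_⟩
  rintro a b (hab | hab)
  · exact hX a b hab
  · obtain ⟨c, h1, h2, h3⟩ := hab.unfold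
    exact ⟨c, h1, h2, fun i => Or.inr (h3 i)⟩

theorem CompressedFrom.of_succ {k : ℕ} {g h : Labelling S V}
    (hgh : R.CompressedFrom (k + 1) g h) : R.CompressedFrom k g h := by
  induction k generalizing g h with
  | zero =>
    refine Compressed.coinduct (R.CompressedFrom 1) ?_ hgh
    exact fun a b hab => ⟨a, Relation.ReflTransGen.refl, hab.1, fun i => Or.inr (hab.2 i)⟩
  | succ k ih => exact ⟨hgh.1, fun i => ih (hgh.2 i)⟩

theorem CompressedFrom.mono {k l : ℕ} (hkl : k ≤ l) {g h : Labelling S V}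
    (hgh : R.CompressedFrom l g h) : R.CompressedFrom k g h := by
  induction l, hkl using Nat.le_induction with
  | base => exact hgh
  | succ l _ ih => exact ih hgh.of_succ

theorem CompressedFrom.below {k : ℕ} {q : List ℕ} {g h : Labelling S V}
    (hgh : R.CompressedFrom (q.length + k) g h) :
    R.CompressedFrom k (below g q) (below h q) := by
  induction q generalizing g h with
  | nil => simpa [below_nil] using hgh
  | cons i q ih =>
    have hgh' : R.CompressedFrom (q.length + k + 1) g h := by
      convert hgh using 1; simp; omega
    have := ih (hgh'.2 i)
    rwa [below_below, below_below] at this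

theorem CompressedFrom.eq_of_length_lt {k : ℕ} {g h : Labelling S V}
    (hgh : R.CompressedFrom k g h) {q : List ℕ} (hq : q.length < k) : g q = h q := by
  obtain ⟨m, rfl⟩ := Nat.exists_eq_add_of_lt hq
  have := (hgh.below (k := m + 1) (q := q)).1
  simpa [InfRewriting.below] using this

/-- One layer of the coinductive definition is unfolded at each position of depth `k`;
`DeepSteps.node` assembles these finitely many finite sequences into one. -/
theorem CompressedFrom.extract {k : ℕ} {g h : Labelling S V} (hg : IsPreterm g)
    (hgh : R.CompressedFrom k g h) :
    ∃ c, R.DeepSteps k g c ∧ R.CompressedFrom (k + 1) c h := by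
  induction k generalizing g h with
  | zero => exact hgh.unfold
  | succ k ih =>
    choose c hc hc' using fun i => ih (hg.below [i]) (hgh.2 i)
    exact ⟨node (g []) c, DeepSteps.node hg hc, hgh.1, hc'⟩

theorem CompressedFrom.extract_le {k l : ℕ} (hkl : k ≤ l) {g h : Labelling S V}
    (hg : IsPreterm g) (hgh : R.CompressedFrom k g h) :
    ∃ c, R.DeepSteps k g c ∧ R.CompressedFrom l c h := by
  induction l, hkl using Nat.le_induction with
  | base => exact ⟨g, Relation.ReflTransGen.refl, hgh⟩
  | succ l hl ih =>
    obtain ⟨c, h1, h2⟩ := ih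
    obtain ⟨c', h3, h4⟩ := h2.extract (h1.isPreterm hg)
    exact ⟨c', h1.trans (h3.mono hl), h4⟩

/-- Coinduction along the depth: whole labellings are rewritten at depth at least `k`, instead of
treating each subterm separately. -/
theorem CompressedFrom.coinduct (X : ℕ → Labelling S V → Labelling S V → Prop)
    (hX : ∀ k a b, X k a b → (∀ q : List ℕ, q.length < k → a q = b q) ∧
      ∃ c, R.DeepSteps k a c ∧ X (k + 1) c b)
    {k : ℕ} {g h : Labelling S V} (hgh : X k g h) : R.CompressedFrom k g h := by
  have h0 : ∀ a b q, X q.length a b →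
      R.Compressed (InfRewriting.below a q) (InfRewriting.below b q) := by
    intro a b q hab
    -- The invariant restricts related pairs to positions `q` whose length is exactly the current
    -- depth.
    refine Compressed.coinduct (fun g h => ∃ a b q, X q.length a b ∧
      g = InfRewriting.below a q ∧ h = InfRewriting.below b q) ?_ ⟨a, b, q, hab, rfl, rfl⟩
    rintro _ _ ⟨a, b, q, hab, rfl, rfl⟩
    obtain ⟨-, c, h1, h2⟩ := hX _ a b hab
    refine ⟨InfRewriting.below c q, DeepSteps.below (by simpa using h1), ?_, fun i => Or.inl ?_⟩
    · simpa [InfRewriting.below] using (hX _ c b h2).1 q (by omega)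
    · exact ⟨c, b, q ++ [i], by simpa using h2, below_below .., below_below ..⟩
  have h1 : ∀ j a b q, X (q.length + j) a b →
      R.CompressedFrom j (InfRewriting.below a q) (InfRewriting.below b q) := by
    intro j
    induction j with
    | zero => exact fun a b q hab => h0 a b q hab
    | succ j ih =>
      intro a b q hab
      refine ⟨?_, fun i => ?_⟩
      · simpa [InfRewriting.below] using (hX _ a b hab).1 q (by omega)
      · rw [below_below, below_below]
        exact ih a b (q ++ [i]) (by convert hab using 1; simp; omega)
  simpa [below_nil] using h1 k g h [] (by simpa using hgh)

theorem CompressedFrom.refl (k : ℕ) (g : Labelling S V) : R.CompressedFrom k g g :=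
  CompressedFrom.coinduct (fun _ a b => a = b)
    (fun _ a _ h => ⟨fun q _ => congrFun h q, a, Relation.ReflTransGen.refl, h⟩) rfl

/-! ### Substitutions and projection of single steps -/

theorem below_substFun (σ : V → ITerm S V) (g : Labelling S V) (f : S.Sym)
    (h : g [] = some (Sum.inl f)) (i : ℕ) :
    InfRewriting.below (fun p => substFun σ p g) [i] =
      fun p => substFun σ p (InfRewriting.below g [i]) := by
  funext p
  exact substFun_cons σ i p g f h

theorem Compressed.substFun {σ τ : V → ITerm S V} {g : Labelling S V}
    (h : ∀ p x, g p = some (Sum.inr x) → R.Compressed (σ x).label (τ x).label) :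
    R.Compressed (fun p => substFun σ p g) (fun p => InfRewriting.substFun τ p g) := by
  have key : ∀ g : Labelling S V,
      (∀ p x, g p = some (Sum.inr x) → R.Compressed (σ x).label (τ x).label) →
      ∃ c, R.DeepSteps 0 (fun p => InfRewriting.substFun σ p g) c ∧
        c [] = InfRewriting.substFun τ [] g ∧ ∀ i, (∃ g' : Labelling S V,
          (∀ p x, g' p = some (Sum.inr x) → R.Compressed (σ x).label (τ x).label) ∧
          InfRewriting.below c [i] = (fun p => InfRewriting.substFun σ p g') ∧
          InfRewriting.below (fun p => InfRewriting.substFun τ p g) [i] =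
            (fun p => InfRewriting.substFun τ p g')) ∨
        R.Compressed (InfRewriting.below c [i])
          (InfRewriting.below (fun p => InfRewriting.substFun τ p g) [i]) := by
    intro g h
    rcases h0 : g [] with _ | (f | x)
    · refine ⟨_, Relation.ReflTransGen.refl, ?_, fun i => Or.inr ?_⟩
      · rw [substFun_none _ _ _ h0, substFun_none _ _ _ h0]
      · have : (fun p => InfRewriting.substFun σ p g) = fun p => InfRewriting.substFun τ p g := by
          funext p; rw [substFun_none _ _ _ h0, substFun_none _ _ _ h0]
        rw [this]
        exact CompressedFrom.refl 0 _
    · refine ⟨_, Relation.ReflTransGen.refl, ?_, fun i => Or.inl ⟨InfRewriting.below g [i], ?_,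
        below_substFun σ g f h0 i, below_substFun τ g f h0 i⟩⟩
      · rw [substFun_nil _ _ _ h0, substFun_nil _ _ _ h0]
      · exact fun p x hp => h _ x hp
    · have e1 : (fun p => InfRewriting.substFun σ p g) = (σ x).label := by
        funext p; exact substFun_var σ p g x h0
      have e2 : (fun p => InfRewriting.substFun τ p g) = (τ x).label := by
        funext p; exact substFun_var τ p g x h0
      obtain ⟨c, h1, h2, h3⟩ := (h [] x h0).unfold
      refine ⟨c, by rwa [e1], by rw [h2, ← e2], fun i => Or.inr ?_⟩
      rw [e2]
      exact h3 i
  refine Compressed.coinduct (fun a b => ∃ g : Labelling S V,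
      (∀ p x, g p = some (Sum.inr x) → R.Compressed (σ x).label (τ x).label) ∧
      a = (fun p => InfRewriting.substFun σ p g) ∧ b = (fun p => InfRewriting.substFun τ p g)) ?_
      ⟨g, h, rfl, rfl⟩
  rintro _ _ ⟨g, h, rfl, rfl⟩
  exact key g h

theorem CompressedFrom.substFun {k : ℕ} {σ τ : V → ITerm S V} {g : Labelling S V}
    (h : ∀ p x, g p = some (Sum.inr x) → R.CompressedFrom k (σ x).label (τ x).label) :
    R.CompressedFrom k (fun p => substFun σ p g) (fun p => InfRewriting.substFun τ p g) := by
  induction k generalizing g with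
  | zero => exact Compressed.substFun h
  | succ k ih =>
    rcases h0 : g [] with _ | (f | x)
    · have : (fun p => InfRewriting.substFun σ p g) = fun p => InfRewriting.substFun τ p g := by
        funext p; rw [substFun_none _ _ _ h0, substFun_none _ _ _ h0]
      rw [this]
      exact CompressedFrom.refl _ _
    · refine ⟨?_, fun i => ?_⟩
      · change InfRewriting.substFun σ [] g = InfRewriting.substFun τ [] g
        rw [substFun_nil _ _ _ h0, substFun_nil _ _ _ h0]
      · rw [below_substFun σ g f h0 i, below_substFun τ g f h0 i]
        -- Below the root one level less of agreement is demanded, so the hypothesis on the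
        -- variables may be weakened.
        exact ih fun p x hp => (h (i :: p) x hp).of_succ
    · have e1 : (fun p => InfRewriting.substFun σ p g) = (σ x).label := by
        funext p; exact substFun_var σ p g x h0
      have e2 : (fun p => InfRewriting.substFun τ p g) = (τ x).label := by
        funext p; exact substFun_var τ p g x h0
      rw [e1, e2]
      exact h [] x h0

/-- Pattern matching: this recognises a labelling as an instance of a left-hand side. Outside the
pattern `u` is undefined because it carries the same symbols, hence the same arities. -/
theorem eq_substFun {σ : V → ITerm S V} {g u : Labelling S V} (hg : IsPreterm g)
    (hu : IsPreterm u) (h0 : (g []).isSome)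
    (hf : ∀ p f, g p = some (Sum.inl f) → u p = some (Sum.inl f))
    (hx : ∀ p x, g p = some (Sum.inr x) → InfRewriting.below u p = (σ x).label) :
    u = fun p => substFun σ p g := by
  funext p
  induction p generalizing g u with
  | nil =>
    obtain ⟨f | x, ha⟩ := Option.isSome_iff_exists.1 h0
    · rw [substFun_nil σ g f ha, hf _ _ ha]
    · rw [substFun_var σ _ g x ha, ← hx _ _ ha]; rfl
  | cons i p ih =>
    obtain ⟨f | x, ha⟩ := Option.isSome_iff_exists.1 h0
    · rw [substFun_cons σ i p g f ha]
      by_cases hi : (g [i]).isSome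
      · exact ih (g := InfRewriting.below g [i]) (u := InfRewriting.below u [i])
          (hg.below [i]) (hu.below [i]) hi (fun q f hq => hf _ f hq)
          (fun q x hq => by rw [below_below]; exact hx _ x hq)
      · have hui : u [i] = none := by
          have h1 := hu [] i
          have h2 := hg [] i
          rw [hf _ _ ha, ← ha, ← h2] at h1
          simpa [hi] using h1
        rw [substFun_none σ p _ (by simpa using hi)]
        exact hu.eq_none hui p
    · rw [substFun_var σ _ g x ha, ← hx _ _ ha]; rfl

/-- Agreement down to the depth of the finite pattern makes `u` a redex for the same rule, with the
subterms of `u` at the variable positions as substitution. These are related to those of `v`, and so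
are the two instances of the right-hand side. `N` depends only on the step from `v`, not on `k` or
`u`. -/
theorem CompressedFrom.project_root (hR : R.LeftLinear) {v w : Labelling S V}
    (hs : R.LabelStep [] v w) : ∃ N, ∀ (k : ℕ) (u : Labelling S V), IsPreterm u →
      R.CompressedFrom (k + N) u v → ∃ w', R.LabelStep [] u w' ∧ R.CompressedFrom k w' w := by
  classical
  obtain ⟨ρ, hρ, σ, h1, h2, -⟩ := hs
  rw [below_nil] at h1 h2
  obtain ⟨N, hN⟩ : ∃ N, ∀ p, (ρ.lhs.label p).isSome → p.length < N := by
    obtain ⟨B, hB⟩ := (ρ.lhs_finite.image List.length).bddAbove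
    exact ⟨B + 1, fun p hp => Nat.lt_succ_of_le (hB ⟨p, hp, rfl⟩)⟩
  refine ⟨N, fun k u hu huv => ?_⟩
  have hagree : ∀ p, (ρ.lhs.label p).isSome → u p = v p :=
    fun p hp => huv.eq_of_length_lt (by have := hN p hp; omega)
  have hvar : ∀ p x, ρ.lhs.label p = some (Sum.inr x) → InfRewriting.below v p = (σ x).label := by
    intro p x hp
    rw [h1]
    funext q
    exact ITerm.subst_at_var σ ρ.lhs p q x hp
  have hfun : ∀ p f, ρ.lhs.label p = some (Sum.inl f) → v p = some (Sum.inl f) := by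
    intro p f hp
    rw [h1]
    rcases ITerm.subst_at_of_not σ ρ.lhs p (by
      rintro q r x rfl hq
      have hr : r ≠ [] := by rintro rfl; simp [hq] at hp
      obtain ⟨i, r, rfl⟩ := List.exists_cons_of_ne_nil hr
      have h3 : ρ.lhs.label (q ++ [i]) = none := by
        by_contra hne
        obtain ⟨f, hf, -⟩ := (ρ.lhs.isTerm.2 q i).1
          (by simpa [Option.isSome_iff_ne_none] using hne)
        simp [hq] at hf
      have := ρ.lhs.isPreterm.eq_none h3 r
      simp [hp] at this) with ⟨-, h4⟩ | ⟨f', h3, h4⟩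
    · simp [hp] at h4
    · rw [h3, ← h4, hp]
  have hterm : ∀ p x, ρ.lhs.label p = some (Sum.inr x) → IsTerm (InfRewriting.below u p) := by
    intro p x hp
    refine ⟨?_, hu.below p⟩
    have h3 := congrFun (hvar p x hp) []
    have h4 := hagree p (by simp [hp])
    simp only [InfRewriting.below, List.append_nil] at h3 ⊢
    rw [h4, h3]
    exact (σ x).isTerm.1
  -- Left-linearity makes the chosen occurrence the only one. Variables absent from the left-hand
  -- side receive the dummy value `σ x`; they do not occur on the right either.
  let τ : V → ITerm S V := fun x =>
    if h : ∃ p, ρ.lhs.label p = some (Sum.inr x) then ⟨InfRewriting.below u h.choose,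
      hterm _ x h.choose_spec⟩ else σ x
  have hτ : ∀ p x, ρ.lhs.label p = some (Sum.inr x) → InfRewriting.below u p = (τ x).label := by
    intro p x hp
    have h : ∃ p, ρ.lhs.label p = some (Sum.inr x) := ⟨p, hp⟩
    have hp' : h.choose = p := hR ρ hρ _ _ x h.choose_spec hp
    simp only [τ, dif_pos h, hp']
  have hu' : u = (ρ.lhs.subst τ).label :=
    eq_substFun ρ.lhs.isPreterm hu ρ.lhs.isTerm.1
      (fun p f hp => by rw [hagree p (by simp [hp]), hfun p f hp]) hτ
  refine ⟨(ρ.rhs.subst τ).label, ⟨ρ, hρ, τ, hu', rfl, fun q hq => absurd List.nil_prefix hq⟩, ?_⟩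
  rw [h2]
  refine CompressedFrom.substFun fun p x hp => ?_
  obtain ⟨q, hq⟩ := ρ.vars_subset ⟨p, hp⟩
  rw [← hτ q x hq, ← hvar q x hq]
  -- `q` is shorter than `N`, so at least `k` levels of agreement survive below `q`.
  refine CompressedFrom.below (CompressedFrom.mono ?_ huv)
  have := hN q (by simp [hq])
  omega

theorem CompressedFrom.project (hR : R.LeftLinear) {p : List ℕ} {v w : Labelling S V}
    (hs : R.LabelStep p v w) : ∃ N, ∀ (k : ℕ) (u : Labelling S V), IsPreterm u →
      R.CompressedFrom (p.length + k + N) u v →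
        ∃ w', R.LabelStep p u w' ∧ R.CompressedFrom (p.length + k) w' w := by
  induction p generalizing v w with
  | nil => simpa using CompressedFrom.project_root hR hs
  | cons i p ih =>
    obtain ⟨N, hN⟩ := ih hs.child
    refine ⟨N, fun k u hu huv => ?_⟩
    have huv' : R.CompressedFrom (p.length + k + N + 1) u v := by
      convert huv using 1; simp; omega
    obtain ⟨c, h1, h2⟩ := hN k _ (hu.below [i]) (huv'.2 i)
    refine ⟨node (u []) (Function.update (fun j => InfRewriting.below u [j]) i c),
      LabelStep.cons rfl (by simpa [below_node] using h1)
        fun j hj => by simp [below_node, hj], ?_⟩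
    have : R.CompressedFrom (p.length + k + 1)
      (node (u []) (Function.update (fun j => InfRewriting.below u [j]) i c)) w := by
      refine ⟨by rw [node_nil, huv'.1, hs.root_eq], fun j => ?_⟩
      rw [below_node]
      by_cases hj : j = i
      · subst hj; simpa using h2
      · rw [Function.update_of_ne hj, ← hs.child_of_ne hj]
        exact CompressedFrom.mono (by omega) (huv'.2 j)
    convert this using 1; simp; omega

/-- Enough of the compressed sequence is performed to reach the agreement required by `project`, and
then the same redex is contracted. The resulting depth `k` is free: more agreement costs only more
steps beforehand, all of depth at least `m`. -/
theorem CompressedFrom.commute (hR : R.LeftLinear) {p : List ℕ} {m k : ℕ}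
    {u v w : Labelling S V} (hu : IsPreterm u) (huv : R.CompressedFrom m u v)
    (hs : R.LabelStep p v w) :
    ∃ u' w', R.DeepSteps m u u' ∧ R.LabelStep p u' w' ∧ R.CompressedFrom k w' w := by
  obtain ⟨N, hN⟩ := CompressedFrom.project hR hs
  obtain ⟨u', h1, h2⟩ := huv.extract_le (Nat.le_add_right m (p.length + k + N)) hu
  obtain ⟨w', h3, h4⟩ := hN k u' (h1.isPreterm hu) (h2.mono (by omega))
  exact ⟨u', w', h1, h3, h4.mono (by omega)⟩

theorem CompressedFrom.of_deepSteps {k : ℕ} {g m h : Labelling S V} (h1 : R.DeepSteps k g m)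
    (h2 : IsPreterm g) (h3 : R.CompressedFrom k m h) : R.CompressedFrom k g h := by
  refine CompressedFrom.coinduct (fun k g h => IsPreterm g ∧
    ∃ m, R.DeepSteps k g m ∧ R.CompressedFrom k m h) ?_ ⟨h2, m, h1, h3⟩
  rintro k a b ⟨ha, m, h1, h2⟩
  refine ⟨fun q hq => (h1.eq_of_length_lt hq).trans (h2.eq_of_length_lt hq), ?_⟩
  obtain ⟨c, h3, h4⟩ := h2.extract (h1.isPreterm ha)
  exact ⟨c, h1.trans h3, (h1.trans h3).isPreterm ha, c, Relation.ReflTransGen.refl, h4⟩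

theorem CompressedFrom.tail (hR : R.LeftLinear) {p : List ℕ} {k : ℕ} (hk : k ≤ p.length)
    {u v w : Labelling S V} (hu : IsPreterm u) (huv : R.CompressedFrom k u v)
    (hs : R.LabelStep p v w) : R.CompressedFrom k u w := by
  obtain ⟨u', w', h1, h2, h3⟩ := huv.commute (k := k) hR hu hs
  exact h3.of_deepSteps (h1.trans (h2.deepSteps hk)) hu

theorem CompressedFrom.trans_deepSteps (hR : R.LeftLinear) {k : ℕ}
    {u v w : Labelling S V} (hu : IsPreterm u) (huv : R.CompressedFrom k u v)
    (hs : R.DeepSteps k v w) : R.CompressedFrom k u w := by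
  induction hs with
  | refl => exact huv
  | tail _ h ih => obtain ⟨p, hk, hp⟩ := h; exact ih.tail hR hk hu hp

/-- The finitely many steps of one layer of the second sequence are absorbed into the first by
`trans_deepSteps`; then one layer of the first is extracted, and the situation recurs at depth `k +
1`. -/
theorem CompressedFrom.trans (hR : R.LeftLinear) {k : ℕ} {u v w : Labelling S V}
    (hu : IsPreterm u) (hv : IsPreterm v) (huv : R.CompressedFrom k u v)
    (hvw : R.CompressedFrom k v w) : R.CompressedFrom k u w := by
  refine CompressedFrom.coinduct (fun k a b => IsPreterm a ∧ ∃ m, IsPreterm m ∧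
    R.CompressedFrom k a m ∧ R.CompressedFrom k m b) ?_ ⟨hu, v, hv, huv, hvw⟩
  rintro k a b ⟨ha, m, hm, h1, h2⟩
  refine ⟨fun q hq => (h1.eq_of_length_lt hq).trans (h2.eq_of_length_lt hq), ?_⟩
  obtain ⟨m', h3, h4⟩ := h2.extract hm
  obtain ⟨c, h5, h6⟩ := (h1.trans_deepSteps hR ha h3).extract ha
  exact ⟨c, h5, h5.isPreterm ha, m', h3.isPreterm hm, h6, h4⟩

end ITRS

end Compression

end InfRewriting

namespace InfRewriting

/-! ### Compression of transfinite sequences -/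

section Transfinite

variable {S : Signature.{u}} {V : Type v}

/-- A transfinite rewrite sequence of length `α`, in terms of labellings, with strong convergence
at all limit ordinals up to and including `α`. -/
structure ITRS.IsLabelSeq (R : ITRS S V) (f : Ordinal.{w} → Labelling S V)
    (pos : Ordinal.{w} → List ℕ) (α : Ordinal.{w}) : Prop where
  isPreterm : ∀ β, IsPreterm (f β)
  step : ∀ β < α, R.LabelStep (pos β) (f β) (f (Order.succ β))
  limit : ∀ l ≤ α, Order.IsSuccLimit l → ∀ k : ℕ, ∃ γ < l, ∀ β, γ ≤ β → β < l →
    k < (pos β).length ∧ ∀ q : List ℕ, q.length ≤ k → f β q = f l q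

namespace ITRS.IsLabelSeq

variable {R : ITRS S V} {f : Ordinal.{w} → Labelling S V} {pos : Ordinal.{w} → List ℕ}
  {α : Ordinal.{w}}

theorem eq_of_length_lt (hf : R.IsLabelSeq f pos α) {k : ℕ} {a b : Ordinal.{w}} (hab : a ≤ b)
    (hb : b ≤ α) (hk : ∀ c, a ≤ c → c < b → k ≤ (pos c).length) {q : List ℕ}
    (hq : q.length < k) : f a q = f b q := by
  induction b using Ordinal.limitRecOn with
  | zero => rw [le_antisymm hab (zero_le)]
  | add_one b ih =>
    rw [← Order.succ_eq_add_one] at hab hb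
    simp only [← Order.succ_eq_add_one] at hk ⊢
    rcases hab.eq_or_lt with rfl | hlt
    · rfl
    · have hab' := Order.lt_succ_iff.1 hlt
      have hbα := (Order.lt_succ b).trans_le hb
      rw [ih hab' hbα.le fun c h1 h2 => hk c h1 (h2.trans (Order.lt_succ b))]
      exact (hf.step b hbα).eq_of_length_lt (hq.trans_le (hk b hab' (Order.lt_succ b)))
  | limit l hl ih =>
    rcases hab.eq_or_lt with rfl | hlt
    · rfl
    · obtain ⟨γ, hγ, h⟩ := hf.limit l hb hl k
      have hm := max_lt hγ hlt
      rw [ih _ hm (le_max_right _ _) (hm.le.trans hb)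
        fun c h1 h2 => hk c h1 (h2.trans hm)]
      exact (h _ (le_max_left _ _) hm).2 q hq.le

/-- At a limit, strong convergence confines the steps of depth at most `k` to a proper initial
segment, where the induction hypothesis applies. -/
theorem exists_last (hf : R.IsLabelSeq f pos α) (k : ℕ) {a b : Ordinal.{w}} (hab : a ≤ b)
    (hb : b ≤ α) : (∀ c, a ≤ c → c < b → k < (pos c).length) ∨
      ∃ c, a ≤ c ∧ c < b ∧ (pos c).length ≤ k ∧
        ∀ c', Order.succ c ≤ c' → c' < b → k < (pos c').length := by
  induction b using Ordinal.limitRecOn with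
  | zero => exact Or.inl fun c _ h => absurd h (not_lt_zero)
  | add_one b ih =>
    rw [← Order.succ_eq_add_one] at hab hb
    simp only [← Order.succ_eq_add_one]
    rcases hab.eq_or_lt with rfl | hlt
    · exact Or.inl fun c h1 h2 => absurd h1 h2.not_ge
    · have hab' := Order.lt_succ_iff.1 hlt
      by_cases hbk : (pos b).length ≤ k
      · exact Or.inr ⟨b, hab', Order.lt_succ b, hbk, fun c' h1 h2 => absurd h1 h2.not_ge⟩
      · have hlast : ∀ c, c < Order.succ b → (c < b → k < (pos c).length) →
            k < (pos c).length := by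
          intro c h1 h2
          rcases (Order.lt_succ_iff.1 h1).eq_or_lt with rfl | h
          · omega
          · exact h2 h
        rcases ih hab' ((Order.le_succ b).trans hb) with h | ⟨c, h1, h2, h3, h4⟩
        · exact Or.inl fun c h1 h2 => hlast c h2 (h c h1)
        · exact Or.inr ⟨c, h1, h2.trans (Order.lt_succ b), h3,
            fun c' h5 h6 => hlast c' h6 (h4 c' h5)⟩
  | limit l hl ih =>
    rcases hab.eq_or_lt with rfl | hlt
    · exact Or.inl fun c h1 h2 => absurd h1 h2.not_ge
    · obtain ⟨γ, hγ, h⟩ := hf.limit l hb hl k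
      have hm := max_lt hγ hlt
      have hlast : ∀ c, c < l → (c < max γ a → k < (pos c).length) → k < (pos c).length := by
        intro c h1 h2
        rcases lt_or_ge c (max γ a) with h' | h'
        · exact h2 h'
        · exact (h c ((le_max_left _ _).trans h') h1).1
      rcases ih _ hm (le_max_right _ _) (hm.le.trans hb) with h' | ⟨c, h1, h2, h3, h4⟩
      · exact Or.inl fun c h1 h2 => hlast c h2 (h' c h1)
      · exact Or.inr ⟨c, h1, h2.trans hm, h3, fun c' h5 h6 => hlast c' h6 (h4 c' h5)⟩

/-- Transfinite rewrite sequences can be compressed, without regard to the number of steps. -/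
theorem compressedFrom (hf : R.IsLabelSeq f pos α) (hR : R.LeftLinear) {b : Ordinal.{w}}
    (hb : b ≤ α) {a : Ordinal.{w}} (hab : a ≤ b) {k : ℕ}
    (hk : ∀ c, a ≤ c → c < b → k ≤ (pos c).length) : R.CompressedFrom k (f a) (f b) := by
  induction b using WellFoundedLT.induction generalizing a k with
  | _ b ih =>
  -- The target `f b` stays fixed while `a` moves towards it: `g` has already simulated the sequence
  -- up to `a`, and the steps from `a` on have depth at least `k`.
  refine CompressedFrom.coinduct (fun k g h => IsPreterm g ∧ h = f b ∧ ∃ a ≤ b,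
    (∀ c, a ≤ c → c < b → k ≤ (pos c).length) ∧ R.CompressedFrom k g (f a)) ?_
    ⟨hf.isPreterm a, rfl, a, hab, hk, CompressedFrom.refl _ _⟩
  rintro k g _ ⟨hg, rfl, a, hab, hk, hga⟩
  refine ⟨fun q hq => (hga.eq_of_length_lt hq).trans (hf.eq_of_length_lt hab hb hk hq), ?_⟩
  rcases hf.exists_last k hab hb with h | ⟨c, h1, h2, h3, h4⟩
  · obtain ⟨m, hm, hm'⟩ := hga.extract hg
    exact ⟨m, hm, hm.isPreterm hg, rfl, a, hab, h, hm'⟩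
  · have hac := ih c h2 (h2.le.trans hb) h1 fun c' h5 h6 => hk c' h5 (h6.trans h2)
    have hgc := (hga.trans hR hg (hf.isPreterm a) hac).tail hR (hk c h1 h2) hg
      (hf.step c (h2.trans_le hb))
    obtain ⟨m, hm, hm'⟩ := hgc.extract hg
    exact ⟨m, hm, hm.isPreterm hg, rfl, _, Order.succ_le_of_lt h2, h4, hm'⟩

end ITRS.IsLabelSeq

/-- The last labelling of a finite rewrite sequence, given by the positions and the results of its
steps. -/
def pathEnd (g : Labelling S V) (l : List (List ℕ × Labelling S V)) : Labelling S V :=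
  l.foldl (fun _ x => x.2) g

/-- Finite rewrite sequences, given by the positions and the results of their steps. -/
def ITRS.IsPath (R : ITRS S V) : Labelling S V → List (List ℕ × Labelling S V) → Prop
  | _, [] => True
  | g, x :: l => R.LabelStep x.1 g x.2 ∧ R.IsPath x.2 l

theorem pathEnd_append (g : Labelling S V) (l l' : List (List ℕ × Labelling S V)) :
    pathEnd g (l ++ l') = pathEnd (pathEnd g l) l' := by
  simp [pathEnd]

/-! ### Finite paths and the count at minimal depth -/

namespace ITRS

variable {R : ITRS S V}

theorem isPath_append {g : Labelling S V} {l l' : List (List ℕ × Labelling S V)} :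
    R.IsPath g (l ++ l') ↔ R.IsPath g l ∧ R.IsPath (pathEnd g l) l' := by
  induction l generalizing g with
  | nil => simp [IsPath, pathEnd]
  | cons x l ih => simp [IsPath, ih, and_assoc, pathEnd]

theorem DeepSteps.exists_path {k : ℕ} {g h : Labelling S V} (hs : R.DeepSteps k g h) :
    ∃ l, R.IsPath g l ∧ pathEnd g l = h ∧ ∀ x ∈ l, k ≤ x.1.length := by
  induction hs with
  | refl => exact ⟨[], trivial, rfl, by simp⟩
  | @tail h1 h2 _ h ih =>
    obtain ⟨p, hk, hp⟩ := h
    obtain ⟨l, hl1, rfl, hl3⟩ := ih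
    refine ⟨l ++ [(p, h2)], isPath_append.2 ⟨hl1, hp, trivial⟩, by simp [pathEnd], ?_⟩
    intro x hx
    rcases List.mem_append.1 hx with h | h
    · exact hl3 x h
    · rw [List.mem_singleton.1 h]; exact hk

theorem IsPath.deepSteps {k : ℕ} {g : Labelling S V} {l : List (List ℕ × Labelling S V)}
    (hl : R.IsPath g l) (hk : ∀ x ∈ l, k ≤ x.1.length) : R.DeepSteps k g (pathEnd g l) := by
  induction l generalizing g with
  | nil => exact Relation.ReflTransGen.refl
  | cons x l ih =>
    exact (hl.1.deepSteps (hk x (by simp))).trans (ih hl.2 fun y hy => hk y (by simp [hy]))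

theorem LabelStep.isTerm {p : List ℕ} {g h : Labelling S V} (hs : R.LabelStep p g h)
    (hg : IsTerm g) : IsTerm h := by
  refine ⟨?_, hs.isPreterm hg.2⟩
  cases p with
  | nil => exact hs.isSome_right
  | cons i p => rw [← hs.root_eq]; exact hg.1

theorem IsPath.isTerm {g : Labelling S V} {l : List (List ℕ × Labelling S V)}
    (hl : R.IsPath g l) (hg : IsTerm g) : IsTerm (pathEnd g l) := by
  induction l generalizing g with
  | nil => exact hg
  | cons x l ih => exact ih hl.2 (hl.1.isTerm hg)

theorem IsPath.prefix {g : Labelling S V} {l l' : List (List ℕ × Labelling S V)}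
    (hl : R.IsPath g l) (h : l' <+: l) : R.IsPath g l' := by
  obtain ⟨r, rfl⟩ := h
  exact (isPath_append.1 hl).1

theorem IsPath.step {g : Labelling S V} {l : List (List ℕ × Labelling S V)}
    (hl : R.IsPath g l) {n : ℕ} (hn : n < l.length) :
    R.LabelStep l[n].1 (pathEnd g (l.take n)) (pathEnd g (l.take (n + 1))) := by
  have h := hl.prefix (List.take_prefix (n + 1) l)
  rw [List.take_succ_eq_append_getElem hn] at h ⊢
  rw [pathEnd_append]
  exact (isPath_append.1 h).2.1

/-- The number of steps at minimal depth is preserved by a finite initial part of the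
compressed sequence. -/
theorem IsLabelSeq.exists_path {f : Ordinal.{w} → Labelling S V} {pos : Ordinal.{w} → List ℕ}
    {α : Ordinal.{w}} (hf : R.IsLabelSeq f pos α) (hR : R.LeftLinear) {d : ℕ} {b : Ordinal.{w}}
    (hb : b ≤ α) (hd : ∀ c < b, d ≤ (pos c).length) :
    ∃ l, R.IsPath (f 0) l ∧ (∀ x ∈ l, d ≤ x.1.length) ∧
      {c | c < b ∧ (pos c).length = d}.encard = l.countP (fun x => x.1.length = d) ∧
      R.CompressedFrom (d + 1) (pathEnd (f 0) l) (f b) := by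
  induction b using WellFoundedLT.induction with
  | _ b ih =>
  -- The cut is at the last step of depth at most `d`, which by minimality has depth exactly `d`.
  rcases hf.exists_last d (zero_le (a := b)) hb with h | ⟨c, -, h2, h3, h4⟩
  · refine ⟨[], trivial, by simp, ?_, hf.compressedFrom hR hb (zero_le) h⟩
    have : {c | c < b ∧ (pos c).length = d} = ∅ := by
      ext c
      simp only [Set.mem_ofPred_eq, Set.mem_empty_iff_false, iff_false, not_and]
      exact fun hc => (h c (zero_le) hc).ne'
    simp [this]
  · obtain ⟨l, l1, l2, l3, l4⟩ := ih c h2 (h2.le.trans hb) fun c' hc' => hd c' (hc'.trans h2)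
    have hpc : (pos c).length = d := le_antisymm h3 (hd c h2)
    have hpre : IsPreterm (pathEnd (f 0) l) := (l1.deepSteps l2).isPreterm (hf.isPreterm 0)
    -- Only steps of depth at least `d + 1` come before the copy of step `c`, so the count grows by
    -- exactly one.
    obtain ⟨u, w, h5, h6, h7⟩ := l4.commute (k := d + 1) hR hpre (hf.step c (h2.trans_le hb))
    obtain ⟨l', m1, rfl, m3⟩ := h5.exists_path
    refine ⟨l ++ (l' ++ [(pos c, w)]), isPath_append.2 ⟨l1, isPath_append.2 ⟨m1, h6, trivial⟩⟩,
      ?_, ?_, ?_⟩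
    · intro x hx
      simp only [List.mem_append, List.mem_singleton] at hx
      rcases hx with h | h | rfl
      · exact l2 x h
      · exact (Nat.le_succ d).trans (m3 x h)
      · exact hpc.ge
    · have hset : {c | c < b ∧ (pos c).length = d} =
          insert c {c' | c' < c ∧ (pos c').length = d} := by
        ext c'
        simp only [Set.mem_ofPred_eq, Set.mem_insert_iff]
        constructor
        · rintro ⟨h8, h9⟩
          rcases lt_trichotomy c' c with h | h | h
          · exact Or.inr ⟨h, h9⟩
          · exact Or.inl h
          · have := h4 c' (Order.succ_le_of_lt h) h8
            omega
        · rintro (rfl | ⟨h8, h9⟩)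
          · exact ⟨h2, hpc⟩
          · exact ⟨h8.trans h2, h9⟩
      have hzero : l'.countP (fun x => x.1.length = d) = 0 := by
        rw [List.countP_eq_zero]
        intro x hx
        have := m3 x hx
        simp only [decide_eq_true_eq]
        omega
      rw [hset, Set.encard_insert_of_notMem (by simp), l3]
      simp [List.countP_append, hzero, hpc]
    · have hw : pathEnd (f 0) (l ++ (l' ++ [(pos c, w)])) = w := by
        simp [pathEnd]
      rw [hw]
      exact h7.trans hR (h6.isPreterm ((m1.deepSteps m3).isPreterm hpre)) (hf.isPreterm _)
        (hf.compressedFrom hR hb (Order.succ_le_of_lt h2) h4)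

end ITRS

theorem encard_setOf_getElem? {A : Type*} (p : A → Prop) [DecidablePred p] (l : List A) :
    {n : ℕ | ∃ x, l[n]? = some x ∧ p x}.encard = l.countP p := by
  induction l using List.reverseRecOn with
  | nil => simp
  | append_singleton l a ih =>
    have h1 : ∀ n x, (l ++ [a])[n]? = some x ↔ l[n]? = some x ∨ (n = l.length ∧ a = x) := by
      intro n x
      rcases lt_trichotomy n l.length with h | h | h
      · simp [List.getElem?_append_left h, h.ne]
      · simp [h]
      · rw [List.getElem?_eq_none (by simp; omega), List.getElem?_eq_none (by omega)]
        simp [h.ne']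
    by_cases ha : p a
    · have : {n : ℕ | ∃ x, (l ++ [a])[n]? = some x ∧ p x} =
          insert l.length {n : ℕ | ∃ x, l[n]? = some x ∧ p x} := by
        ext n
        simp only [h1, Set.mem_ofPred_eq, Set.mem_insert_iff]
        constructor
        · rintro ⟨x, h | ⟨h, -⟩, hx⟩
          · exact Or.inr ⟨x, h, hx⟩
          · exact Or.inl h
        · rintro (h | ⟨x, h, hx⟩)
          · exact ⟨a, Or.inr ⟨h, rfl⟩, ha⟩
          · exact ⟨x, Or.inl h, hx⟩
      rw [this, Set.encard_insert_of_notMem (by simp), ih]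
      simp [List.countP_append, ha]
    · have : {n : ℕ | ∃ x, (l ++ [a])[n]? = some x ∧ p x} =
          {n : ℕ | ∃ x, l[n]? = some x ∧ p x} := by
        ext n
        simp only [h1, Set.mem_ofPred_eq]
        constructor
        · rintro ⟨x, h | ⟨-, rfl⟩, hx⟩
          · exact ⟨x, h, hx⟩
          · exact absurd hx ha
        · rintro ⟨x, h, hx⟩
          exact ⟨x, Or.inl h, hx⟩
      rw [this, ih]
      simp [List.countP_append, ha]

end Transfinite

end InfRewriting

namespace InfRewriting

/-! ### Back to rewrite sequences of terms -/

section Final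

variable {S : Signature.{u}} {V : Type v} {R : ITRS S V}

theorem eq_of_termDist_lt {s t : ITerm S V} {k : ℕ} (h : termDist s t < (2⁻¹ : ℝ) ^ k)
    {q : List ℕ} (hq : q.length ≤ k) : s.label q = t.label q := by
  by_contra hne
  have hst : s ≠ t := by rintro rfl; exact hne rfl
  rw [termDist, if_neg hst] at h
  have h1 := (pow_lt_pow_iff_right_of_lt_one₀ (by norm_num) (by norm_num)).1 h
  have h2 : sInf {k : ℕ | ∃ p : List ℕ, p.length = k ∧ s.label p ≠ t.label p} ≤ q.length :=
    Nat.sInf_le ⟨q, rfl, hne⟩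
  omega

theorem termDist_lt {s t : ITerm S V} {k : ℕ}
    (h : ∀ q : List ℕ, q.length ≤ k → s.label q = t.label q) :
    termDist s t < (2⁻¹ : ℝ) ^ k := by
  rw [termDist]
  split_ifs with hst
  · positivity
  · refine (pow_lt_pow_iff_right_of_lt_one₀ (by norm_num) (by norm_num)).2 ?_
    have hne : {k : ℕ | ∃ p : List ℕ, p.length = k ∧ s.label p ≠ t.label p}.Nonempty := by
      by_contra hemp
      refine hst (ITerm.ext (funext fun p => ?_))
      by_contra hp
      exact hemp ⟨p.length, p, rfl, hp⟩
    obtain ⟨p, hp, hp'⟩ := Nat.sInf_mem hne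
    by_contra hlt
    exact hp' (h p (by omega))

-- For a limit `α` the value `κ.term α` is arbitrary, so it is overwritten by the target `t`;
-- otherwise the two coincide.
open Classical in
theorem RewriteSeq.isLabelSeq {α : Ordinal.{w}} {s t : ITerm S V} (κ : RewriteSeq R α)
    (hκ : κ.Reduces s t) :
    R.IsLabelSeq (fun β => (Function.update κ.term α t β).label) κ.pos α := by
  obtain ⟨-, hsc, ht1, ht2⟩ := hκ
  have hlt : ∀ β < α, Function.update κ.term α t β = κ.term β :=
    fun β hβ => Function.update_of_ne hβ.ne _ _
  refine ⟨fun β => ITerm.isPreterm _, fun β hβ => ?_, fun l hl hlim k => ?_⟩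
  · rw [hlt β hβ]
    rcases (Order.succ_le_of_lt hβ).eq_or_lt with h | h
    · have hα : κ.term α = t := ht2 (by rw [← h]; exact Order.not_isSuccLimit_succ β)
      have hstep := (κ.step β hβ).labelStep
      rw [h, hα] at hstep
      rwa [h, Function.update_self]
    · rw [hlt _ h]
      exact (κ.step β hβ).labelStep
  · have h1 : TermsTendTo κ.term l (Function.update κ.term α t l) ∧
        DepthsTendToInfinity κ.pos l := by
      rcases hl.eq_or_lt with rfl | h
      · rw [Function.update_self]; exact ⟨ht1 hlim, hsc hlim⟩
      · rw [hlt _ h]; exact ⟨κ.term_cont l h hlim, κ.depth_cont l h hlim⟩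
    obtain ⟨γ, hγ, h2⟩ := h1.1 ((2⁻¹ : ℝ) ^ k) (by positivity)
    obtain ⟨γ', hγ', h3⟩ := h1.2 k
    refine ⟨max γ γ', max_lt hγ hγ', fun β h4 h5 => ⟨h3 β ((le_max_right _ _).trans h4) h5, ?_⟩⟩
    intro q hq
    rw [hlt β (h5.trans_le hl)]
    exact eq_of_termDist_lt (h2 β ((le_max_left _ _).trans h4) h5) hq

theorem not_isSuccLimit_of_lt_omega0 {o : Ordinal.{w}} (h : o < Ordinal.omega0) :
    ¬ Order.IsSuccLimit o :=
  fun hl => absurd (Ordinal.omega0_le_of_isSuccLimit hl) h.not_ge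

/-- The rewrite sequence of length at most `ω` given by sequences of terms and positions. -/
noncomputable def RewriteSeq.ofNat (F : ℕ → ITerm S V) (pos : ℕ → List ℕ) (β : Ordinal.{w})
    (hβ : β ≤ Ordinal.omega0)
    (hs : ∀ n : ℕ, (n : Ordinal.{w}) < β → R.StepAt (pos n) (F n) (F (n + 1))) :
    RewriteSeq R β where
  -- This inverts the cast on finite ordinals; the value 0 at infinite ones is never used.
  term o := F (Cardinal.toNat o.card)
  pos o := pos (Cardinal.toNat o.card)
  step o ho := by
    obtain ⟨n, rfl⟩ := Ordinal.lt_omega0.1 (ho.trans_le hβ)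
    have : Order.succ (n : Ordinal.{w}) = ((n + 1 : ℕ) : Ordinal.{w}) := by
      simp
    rw [this, Ordinal.card_nat, Ordinal.card_nat, Cardinal.toNat_natCast, Cardinal.toNat_natCast]
    exact hs n ho
  term_cont l hl hlim := absurd hlim (not_isSuccLimit_of_lt_omega0 (hl.trans_le hβ))
  depth_cont l hl hlim := absurd hlim (not_isSuccLimit_of_lt_omega0 (hl.trans_le hβ))

section OfNat

variable {F : ℕ → ITerm S V} {pos : ℕ → List ℕ} {β : Ordinal.{w}} {hβ : β ≤ Ordinal.omega0}
  {hs : ∀ n : ℕ, (n : Ordinal.{w}) < β → R.StepAt (pos n) (F n) (F (n + 1))}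

theorem RewriteSeq.ofNat_term (n : ℕ) :
    (RewriteSeq.ofNat F pos β hβ hs).term (n : Ordinal.{w}) = F n := by
  simp [RewriteSeq.ofNat]

theorem RewriteSeq.ofNat_pos (n : ℕ) :
    (RewriteSeq.ofNat F pos β hβ hs).pos (n : Ordinal.{w}) = pos n := by
  simp [RewriteSeq.ofNat]

theorem RewriteSeq.ofNat_le_depth {d : ℕ}
    (h : ∀ n : ℕ, (n : Ordinal.{w}) < β → d ≤ (pos n).length) {γ : Ordinal.{w}} (hγ : γ < β) :
    d ≤ (RewriteSeq.ofNat F pos β hβ hs).depth γ := by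
  obtain ⟨n, rfl⟩ := Ordinal.lt_omega0.1 (hγ.trans_le hβ)
  rw [RewriteSeq.depth, RewriteSeq.ofNat_pos]
  exact h n hγ

theorem RewriteSeq.ofNat_encard_stepsAt (d : ℕ) :
    ((RewriteSeq.ofNat F pos β hβ hs).stepsAt d).encard =
      {n : ℕ | (n : Ordinal.{w}) < β ∧ (pos n).length = d}.encard := by
  have hinj : Function.Injective (fun n : ℕ => (n : Ordinal.{w})) := fun m n h => by simpa using h
  rw [← hinj.encard_image]
  congr 1
  ext γ
  constructor
  · rintro ⟨h1, h2⟩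
    obtain ⟨n, rfl⟩ := Ordinal.lt_omega0.1 (h1.trans_le hβ)
    rw [RewriteSeq.depth, RewriteSeq.ofNat_pos] at h2
    exact ⟨n, ⟨h1, h2⟩, rfl⟩
  · rintro ⟨n, ⟨h1, h2⟩, rfl⟩
    refine ⟨h1, ?_⟩
    rw [RewriteSeq.depth, RewriteSeq.ofNat_pos]
    exact h2

end OfNat

/-- Finite paths as rewrite sequences. -/
theorem ITRS.IsPath.exists_rewriteSeq {s t : ITerm S V} {d : ℕ}
    {l : List (List ℕ × Labelling S V)} (hl : R.IsPath s.label l)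
    (ht : pathEnd s.label l = t.label) (hd : ∀ x ∈ l, d ≤ x.1.length) :
    ∃ β : Ordinal.{w}, β ≤ Ordinal.omega0 ∧ ∃ κ : RewriteSeq R β, κ.Reduces s t ∧
      (∀ γ < β, d ≤ κ.depth γ) ∧
        (κ.stepsAt d).encard = l.countP (fun x => x.1.length = d) := by
  let F : ℕ → ITerm S V := fun n =>
    ⟨pathEnd s.label (l.take n), (hl.prefix (List.take_prefix n l)).isTerm s.isTerm⟩
  let pos : ℕ → List ℕ := fun n => (l[n]?).elim [] Prod.fst
  have hpos : ∀ n (h : n < l.length), pos n = l[n].1 := fun n h => by simp [pos, h]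
  have hβ : (l.length : Ordinal.{w}) ≤ Ordinal.omega0 := (Ordinal.natCast_lt_omega0 _).le
  refine ⟨l.length, hβ, RewriteSeq.ofNat F pos _ hβ ?_, ⟨?_, ?_, ?_, ?_⟩, ?_, ?_⟩
  · intro n hn
    have hn' : n < l.length := by simpa using hn
    rw [hpos n hn']
    exact (hl.step hn').stepAt (s := F n) (t := F (n + 1))
  · rw [← Nat.cast_zero, RewriteSeq.ofNat_term]
    rfl
  · exact fun h => absurd h (not_isSuccLimit_of_lt_omega0 (Ordinal.natCast_lt_omega0 _))
  · exact fun h => absurd h (not_isSuccLimit_of_lt_omega0 (Ordinal.natCast_lt_omega0 _))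
  · intro _
    rw [RewriteSeq.ofNat_term]
    ext1
    simpa [F] using ht
  · intro γ hγ
    refine RewriteSeq.ofNat_le_depth (fun n hn => ?_) hγ
    have hn' : n < l.length := by simpa using hn
    rw [hpos n hn']
    exact hd _ (List.getElem_mem hn')
  · rw [RewriteSeq.ofNat_encard_stepsAt, ← encard_setOf_getElem?]
    congr 1
    ext n
    simp only [Set.mem_ofPred_eq, Nat.cast_lt]
    constructor
    · rintro ⟨h1, h2⟩
      exact ⟨l[n], List.getElem?_eq_getElem h1, by rw [← hpos n h1, h2]⟩
    · rintro ⟨x, h1, h2⟩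
      obtain ⟨h3, rfl⟩ := List.getElem?_eq_some_iff.1 h1
      exact ⟨h3, by rw [hpos n h3, h2]⟩

/-- As long as `t` is not reached, some position still differs, and extracting past its depth forces
at least one step. Hence every block is nonempty and the blocks add up to length ω. -/
theorem exists_infinite_path {s t : ITerm S V} {d : ℕ} {l : List (List ℕ × Labelling S V)}
    (hl : R.IsPath s.label l) (ht : R.CompressedFrom (d + 1) (pathEnd s.label l) t.label)
    (hne : ∀ l', R.IsPath s.label (l ++ l') → (∀ x ∈ l', d + 1 ≤ x.1.length) →
      pathEnd s.label (l ++ l') ≠ t.label) :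
    ∃ L : ℕ → List (List ℕ × Labelling S V), L 0 = l ∧ ∀ i, R.IsPath s.label (L i) ∧
      R.CompressedFrom (d + 1 + i) (pathEnd s.label (L i)) t.label ∧
      ∃ l', l' ≠ [] ∧ L (i + 1) = L i ++ l' ∧ ∀ x ∈ l', d + 1 + i ≤ x.1.length := by
  let P : ℕ → List (List ℕ × Labelling S V) → Prop := fun i m =>
    R.IsPath s.label m ∧ R.CompressedFrom (d + 1 + i) (pathEnd s.label m) t.label ∧
      ∃ l', m = l ++ l' ∧ ∀ x ∈ l', d + 1 ≤ x.1.length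
  have next : ∀ i m, P i m → ∃ m', P (i + 1) m' ∧
      ∃ l', l' ≠ [] ∧ m' = m ++ l' ∧ ∀ x ∈ l', d + 1 + i ≤ x.1.length := by
    rintro i m ⟨hm1, hm2, l', rfl, hm3⟩
    have hne' := hne l' hm1 hm3
    obtain ⟨q, hq⟩ := Function.ne_iff.1 hne'
    -- The extra `q.length + 1` levels ensure agreement at the differing position `q`.
    obtain ⟨c, hc1, hc2⟩ := hm2.extract_le
      (Nat.le_add_right (d + 1 + i) (q.length + 1)) (hm1.isTerm s.isTerm).2
    obtain ⟨r, hr1, rfl, hr3⟩ := hc1.exists_path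
    refine ⟨(l ++ l') ++ r, ⟨ITRS.isPath_append.2 ⟨hm1, hr1⟩, ?_, l' ++ r, by simp, ?_⟩,
      r, ?_, rfl, hr3⟩
    · rw [pathEnd_append]
      exact hc2.mono (by omega)
    · intro x hx
      rcases List.mem_append.1 hx with h | h
      · exact hm3 x h
      · have := hr3 x h; omega
    · rintro rfl
      exact hq (hc2.eq_of_length_lt (by omega))
  choose! N hN hN' using next
  let L : ℕ → List (List ℕ × Labelling S V) := fun i => Nat.rec l (fun i m => N i m) i
  have hL : ∀ i, P i (L i) := by
    intro i
    induction i with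
    | zero => exact ⟨hl, ht, [], by simp [L], by simp⟩
    | succ i ih => exact hN i _ ih
  exact ⟨L, rfl, fun i => ⟨(hL i).1, (hL i).2.1, hN' i _ (hL i)⟩⟩

/-- Infinite paths as rewrite sequences of length `ω`. -/
theorem exists_rewriteSeq_omega0 {s t : ITerm S V} {d : ℕ} {L : ℕ → List (List ℕ × Labelling S V)}
    (hd : ∀ x ∈ L 0, d ≤ x.1.length)
    (hL : ∀ i, R.IsPath s.label (L i) ∧
      R.CompressedFrom (d + 1 + i) (pathEnd s.label (L i)) t.label ∧
      ∃ l', l' ≠ [] ∧ L (i + 1) = L i ++ l' ∧ ∀ x ∈ l', d + 1 + i ≤ x.1.length) :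
    ∃ κ : RewriteSeq R Ordinal.omega0.{w}, κ.Reduces s t ∧
      (∀ γ < Ordinal.omega0, d ≤ κ.depth γ) ∧
        (κ.stepsAt d).encard = (L 0).countP (fun x => x.1.length = d) := by
  have hlen : ∀ i, i ≤ (L i).length := by
    intro i
    induction i with
    | zero => simp
    | succ i ih =>
      obtain ⟨l', h1, h2, -⟩ := (hL i).2.2
      have := List.length_pos_iff.2 h1
      rw [h2, List.length_append]
      omega
  have happ : ∀ i j, i ≤ j → ∃ l', L j = L i ++ l' ∧ ∀ x ∈ l', d + 1 + i ≤ x.1.length := by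
    intro i j hij
    induction j, hij using Nat.le_induction with
    | base => exact ⟨[], by simp, by simp⟩
    | succ j hij ih =>
      obtain ⟨l', h1, h2⟩ := ih
      obtain ⟨l'', -, h3, h4⟩ := (hL j).2.2
      refine ⟨l' ++ l'', by rw [h3, h1, List.append_assoc], fun x hx => ?_⟩
      rcases List.mem_append.1 hx with h | h
      · exact h2 x h
      · have := h4 x h; omega
  have htake : ∀ n j, n ≤ j → (L n).take n = (L j).take n := by
    intro n j hnj
    obtain ⟨l', h1, -⟩ := happ n j hnj
    rw [h1, List.take_append_of_le_length (hlen n)]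
  -- Since the blocks are nonempty, `L n` has at least `n` steps, so its first `n` steps are those
  -- of the limit sequence.
  let F : ℕ → ITerm S V := fun n =>
    ⟨pathEnd s.label ((L n).take n),
      ((hL n).1.prefix (List.take_prefix n _)).isTerm s.isTerm⟩
  have hlt : ∀ n, n < (L (n + 1)).length := fun n => hlen (n + 1)
  let pos : ℕ → List ℕ := fun n => ((L (n + 1))[n]'(hlt n)).1
  have hposL : ∀ i n (h : n < (L i).length), pos n = ((L i)[n]).1 := by
    intro i n h
    simp only [pos]
    rcases le_total i (n + 1) with h' | h'
    · obtain ⟨l', h1, -⟩ := happ _ _ h'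
      simp only [h1, List.getElem_append_left h]
    · obtain ⟨l', h1, -⟩ := happ _ _ h'
      simp only [h1, List.getElem_append_left (hlt n)]
  have hdeep : ∀ i n, (L i).length ≤ n → d + 1 + i ≤ (pos n).length := by
    intro i n h
    obtain ⟨l', h1, h2⟩ := happ i (n + 1) (by have := hlen i; omega)
    simp only [pos, h1, List.getElem_append_right h]
    exact h2 _ (List.getElem_mem _)
  have hconv : ∀ i n, (L i).length ≤ n → ∀ q : List ℕ, q.length < d + 1 + i →
      (F n).label q = t.label q := by
    intro i n h q hq
    obtain ⟨l', h1, h2⟩ := happ i n ((hlen i).trans h)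
    have h3 : (F n).label = pathEnd (pathEnd s.label (L i)) (l'.take (n - (L i).length)) := by
      rw [← pathEnd_append]
      simp only [F, h1, List.take_append, List.take_of_length_le h]
    have h4 := ((ITRS.isPath_append.1 (h1 ▸ (hL n).1)).2.prefix
      (List.take_prefix (n - (L i).length) l')).deepSteps
      fun x hx => h2 x (List.mem_of_mem_take hx)
    rw [h3, ← h4.eq_of_length_lt hq]
    exact (hL i).2.1.eq_of_length_lt hq
  refine ⟨RewriteSeq.ofNat F pos _ le_rfl ?_, ⟨?_, ?_, ?_, ?_⟩, ?_, ?_⟩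
  · intro n _
    refine ITRS.LabelStep.stepAt ?_
    have h := (hL (n + 1)).1.step (hlt n)
    rw [← htake n (n + 1) (Nat.le_succ n)] at h
    exact h
  · rw [← Nat.cast_zero, RewriteSeq.ofNat_term]
    rfl
  · intro _ k
    refine ⟨((L k).length : Ordinal.{w}), Ordinal.natCast_lt_omega0 _, fun β h1 h2 => ?_⟩
    obtain ⟨n, rfl⟩ := Ordinal.lt_omega0.1 h2
    rw [RewriteSeq.ofNat_pos]
    have := hdeep k n (by simpa using h1)
    omega
  · intro _ ε hε
    obtain ⟨k, hk⟩ := exists_pow_lt_of_lt_one hε (show (2⁻¹ : ℝ) < 1 by norm_num)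
    refine ⟨((L k).length : Ordinal.{w}), Ordinal.natCast_lt_omega0 _, fun β h1 h2 => ?_⟩
    obtain ⟨n, rfl⟩ := Ordinal.lt_omega0.1 h2
    rw [RewriteSeq.ofNat_term]
    exact (termDist_lt fun q hq => hconv k n (by simpa using h1) q (by omega)).trans hk
  · exact fun h => absurd Ordinal.isSuccLimit_omega0 h
  · intro γ hγ
    refine RewriteSeq.ofNat_le_depth (fun n _ => ?_) hγ
    rcases lt_or_ge n (L 0).length with h | h
    · rw [hposL 0 n h]
      exact hd _ (List.getElem_mem h)
    · have := hdeep 0 n h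
      omega
  · rw [RewriteSeq.ofNat_encard_stepsAt, ← encard_setOf_getElem?]
    congr 1
    ext n
    simp only [Set.mem_ofPred_eq, Ordinal.natCast_lt_omega0, true_and]
    constructor
    · intro h2
      have h1 : n < (L 0).length := by
        by_contra h
        have := hdeep 0 n (not_lt.1 h)
        omega
      exact ⟨(L 0)[n], List.getElem?_eq_getElem h1, by rw [← hposL 0 n h1, h2]⟩
    · rintro ⟨x, h1, h2⟩
      obtain ⟨h3, rfl⟩ := List.getElem?_eq_some_iff.1 h1
      rw [hposL 0 n h3, h2]

end Final

end InfRewriting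

theorem mainTheorem6 {S : InfRewriting.Signature.{u}} {V : Type v}
    (R : InfRewriting.ITRS S V) (hR : R.LeftLinear)
    (α : Ordinal.{w}) (s t : InfRewriting.ITerm S V)
    (κ : InfRewriting.RewriteSeq R α) (hκ : κ.Reduces s t) :
    ∃ β : Ordinal.{w}, β ≤ Ordinal.omega0 ∧
      ∃ κ' : InfRewriting.RewriteSeq R β, κ'.Reduces s t ∧
        ∀ d : ℕ, IsLeast κ.depths d →
          (∀ γ < β, d ≤ κ'.depth γ) ∧
            ∃ n : ℕ, (κ.stepsAt d).encard = n ∧ (κ'.stepsAt d).encard = n := by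
  classical
  rcases eq_or_ne α 0 with rfl | hα
  · exact ⟨0, zero_le, κ, hκ, fun d ⟨⟨β, hβ, _⟩, _⟩ => absurd hβ not_lt_zero⟩
  have hne : κ.depths.Nonempty := ⟨_, 0, pos_iff_ne_zero.2 hα, rfl⟩
  obtain ⟨d, hd⟩ : ∃ d, IsLeast κ.depths d :=
    ⟨sInf κ.depths, Nat.sInf_mem hne, fun _ h => Nat.sInf_le h⟩
  have hf := κ.isLabelSeq hκ
  obtain ⟨l, h1, h2, h3, h4⟩ := hf.exists_path hR le_rfl fun c hc => hd.2 ⟨c, hc, rfl⟩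
  rw [Function.update_of_ne hα.symm, hκ.1] at h1 h4
  rw [Function.update_self] at h4
  suffices h : ∃ β : Ordinal.{w}, β ≤ Ordinal.omega0 ∧
      ∃ κ' : InfRewriting.RewriteSeq R β, κ'.Reduces s t ∧ (∀ γ < β, d ≤ κ'.depth γ) ∧
        (κ'.stepsAt d).encard = l.countP (fun x => x.1.length = d) by
    obtain ⟨β, hβ, κ', k1, k2, k3⟩ := h
    refine ⟨β, hβ, κ', k1, fun d' hd' => ?_⟩
    obtain rfl := hd'.unique hd
    exact ⟨k2, _, h3, k3⟩
  -- Either some finite continuation at depth greater than `d` reaches `t`, or the extraction never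
  -- stops and has length ω. Neither adds a step at depth `d`.
  by_cases hfin : ∃ l', R.IsPath s.label (l ++ l') ∧ (∀ x ∈ l', d + 1 ≤ x.1.length) ∧
      InfRewriting.pathEnd s.label (l ++ l') = t.label
  · obtain ⟨l', m1, m2, m3⟩ := hfin
    obtain ⟨β, hβ, κ', k1, k2, k3⟩ := m1.exists_rewriteSeq (d := d) m3 fun x hx => by
      rcases List.mem_append.1 hx with h | h
      · exact h2 x h
      · have := m2 x h; omega
    refine ⟨β, hβ, κ', k1, k2, ?_⟩
    have hzero : l'.countP (fun x => x.1.length = d) = 0 := by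
      rw [List.countP_eq_zero]
      intro x hx
      have := m2 x hx
      simp only [decide_eq_true_eq]
      omega
    rw [k3, List.countP_append, hzero, add_zero]
  · obtain ⟨L, rfl, hL⟩ := InfRewriting.exists_infinite_path h1 h4
      fun l' m1 m2 m3 => hfin ⟨l', m1, m2, m3⟩
    exact ⟨_, le_rfl, InfRewriting.exists_rewriteSeq_omega0 h2 hL⟩
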